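/- Let $q$ be a prime power, $\Lambda=\mathbb F_q[T]$ and $F=\mathbb F_q((T^{-1}))$ with the absolute value $|0|=0$, $|a|=e^{\deg a}$, where $\deg a$ is the largest exponent of $T$ occurring in $a\neq 0$. The spaces $F^d$, $F^n$ carry the supremum norm and its metric and topology. For a ball $B=B(x;r)$ put $3B=B(x;3r)$; $\operatorname{supp}\nu$ is the support of a measure $\nu$. For $n\ge 1$ let $\mathfrak a^+$ be the set of tuples $\mathbf t=(t_0,t_1,\dots,t_n)$ of nonnegative integers with $t_0=t_1+\cdots+t_n$, let $\|\mathbf t\|=\max_i t_i$, and call $\mathcal T\subseteq\mathfrak a^+$ unbounded if $\|\cdot\|$ is unbounded on $\mathcal T$. For $\varepsilon>0$, $DI_\varepsilon(\mathcal T)$ is the set of $\mathbf y\in F^n$ for which there is $s>0$ such that for every $\mathbf t\in\mathcal T$ with $\|\mathbf t\|>s$ there is $(p,q_1,\dots,q_n)\in\Lambda^{n+1}\setminus\{\mathbf 0\}$ with $$|y_1q_1+\cdots+y_nq_n-p|<\varepsilon e^{-t_0}\quad\text{and}\quad |q_j|<\varepsilon e^{t_j}\ \ (j=1,\dots,n).$$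 Let $\nu$ be a Radon measure on $F^d$, $U\subseteq F^d$ open, $\mathbf f=(f_1,\dots,f_n):U\to F^n$ and $C,\alpha,D>0$. * $\nu$ is $D$-Federer on $U$ if $\nu(3B)\le D\,\nu(B)$ for every ball $B$ with centre in $\operatorname{supp}\nu$ and $3B\subseteq U$. * $(\mathbf f,\nu)$ is $(C,\alpha)$-good on $U$ if for every $F$-linear combination $g$ of $1,f_1,\dots,f_n$, every ball $B\subseteq U$ with centre in $\operatorname{supp}\nu$ and every $\delta>0$, $$\nu(\{x\in B:|g(x)|<\delta\})\le C\Bigl(\frac{\delta}{\sup_{B\cap\operatorname{supp}\nu}|g|}\Bigr)^{\alpha}\nu(B),$$ where the right-hand side is $\infty$ if the supremum is $0$. * $(\mathbf f,\nu)$ is nonplanar if for every ball $B\subseteq U$ with centre in $\operatorname{supp}\nu$ the restrictions of $1,f_1,\dots,f_n$ to $B\cap\operatorname{supp}\nu$ are linearly independent over $F$. **Theorem.** For all integers $n\ge1$ and reals $C,\alpha,D>0$ there is $\varepsilon_0=\varepsilon_0(n,C,\alpha,D)>0$ with the following property. Let $q$ be any prime power, $d\ge1$, $\nu$ a Radon measure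 on $F^d$, $U\subseteq F^d$ an open set with $\nu(U)>0$ on which $\nu$ is $D$-Federer, and $\mathbf f:U\to F^n$ a continuous map such that $(\mathbf f,\nu)$ is $(C,\alpha)$-good on $U$ and nonplanar. Then for every $0<\varepsilon<\varepsilon_0$ and every unbounded $\mathcal T\subseteq\mathfrak a^+$, $$\mathbf f_*\nu\bigl(DI_\varepsilon(\mathcal T)\bigr)=\nu\bigl(\{x\in U:\mathbf f(x)\in DI_\varepsilon(\mathcal T)\}\bigr)=0.$$ -/

import Mathlib

open MeasureTheory Metric Polynomial

noncomputable section

namespace DirichletFF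

/-! ### The field `F = 𝔽_q((T⁻¹))` -/

/-- The absolute value `|a| = e ^ (deg a)`, `|0| = 0`, on Laurent series, the formal variable of
the series being read as `T⁻¹`: the coefficient of `T ^ j` is the coefficient with index `-j`, and
the largest exponent `deg a` of `T` that occurs in `a` is minus the order of `a`. -/
def absVal (k : Type*) [Field k] : AbsoluteValue (LaurentSeries k) ℝ where
  toFun a := open Classical in if a = 0 then 0 else Real.exp (-((HahnSeries.order a : ℤ) : ℝ))
  map_mul' a b := by
    by_cases ha : a = 0
    · simp [ha]
    by_cases hb : b = 0
    · simp [hb]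
    simp only [ha, hb, mul_eq_zero, or_self, if_false]
    rw [HahnSeries.order_mul ha hb, ← Real.exp_add]
    congr 1
    push_cast
    ring
  nonneg' a := by
    split_ifs
    · exact le_rfl
    · positivity
  eq_zero' a := by
    split_ifs with h
    · simp [h]
    · simp [h, Real.exp_ne_zero]
  add_le' a b := by
    by_cases ha : a = 0
    · rw [show a + b = b by rw [ha, zero_add]]
      simp [ha]
    by_cases hb : b = 0
    · rw [show a + b = a by rw [hb, add_zero]]
      simp [hb]
    by_cases hab : a + b = 0
    · simp only [hab, ha, hb, if_true, if_false]
      positivity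
    have h := HahnSeries.min_order_le_order_add hab
    simp only [hab, ha, hb, if_false]
    rcases min_le_iff.1 h with h | h
    · refine le_trans (Real.exp_le_exp.2 ?_) (le_add_of_nonneg_right (Real.exp_pos _).le)
      exact neg_le_neg (by exact_mod_cast h)
    · refine le_trans (Real.exp_le_exp.2 ?_) (le_add_of_nonneg_left (Real.exp_pos _).le)
      exact neg_le_neg (by exact_mod_cast h)

/-- The field `k((T⁻¹))`: a copy of the field of Laurent series over `k`, with formal variable
`T⁻¹`. -/
def LaurentInv (k : Type*) [Field k] : Type _ := LaurentSeries k

/-- `F` with its absolute value. The spaces `Fin d → F` get from it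
the supremum norm, its metric and its topology. -/
instance (k : Type*) [Field k] : NormedField (LaurentInv k) :=
  (absVal k).toNormedField

/-- A Laurent series in `T⁻¹`, as an element of `F`. -/
def ofSeries (k : Type*) [Field k] : LaurentSeries k ≃+* LaurentInv k := RingEquiv.refl _

/-- `F ^ d` carries its Borel σ-algebra. -/
instance (k : Type*) [Field k] (d : ℕ) : MeasurableSpace (Fin d → LaurentInv k) := borel _

instance (k : Type*) [Field k] (d : ℕ) : BorelSpace (Fin d → LaurentInv k) := ⟨rfl⟩

/-- The element `T` of `k((T⁻¹))`. -/
def elemT (k : Type*) [Field k] : LaurentInv k := ofSeries k (HahnSeries.single (-1) 1)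

/-- The inclusion of `Λ = k[T]` into `k((T⁻¹))`, sending `∑ aⱼ T ^ j` to `∑ aⱼ T ^ j`. -/
def polyEmb (k : Type*) [Field k] : k[X] →+* LaurentInv k :=
  Polynomial.eval₂RingHom ((ofSeries k).toRingHom.comp HahnSeries.C) (elemT k)

/-! ### Dirichlet improvability -/

/-- The set `𝔞⁺` of the tuples `(t₁, …, t_m, t_{m+1}, …, t_{m+n})` of nonnegative integers with
`t₁ + ⋯ + t_m = t_{m+1} + ⋯ + t_{m+n}`. -/
def aPlus (m n : ℕ) : Set (Fin m ⊕ Fin n → ℕ) :=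
  {t | ∑ i, t (Sum.inl i) = ∑ j, t (Sum.inr j)}

/-- The supremum norm of a tuple of nonnegative integers. -/
def tupleNorm {m n : ℕ} (t : Fin m ⊕ Fin n → ℕ) : ℕ := Finset.univ.sup t

/-- Unboundedness of a set of tuples. -/
def IsUnbounded {m n : ℕ} (𝒯 : Set (Fin m ⊕ Fin n → ℕ)) : Prop :=
  ∀ N : ℕ, ∃ t ∈ 𝒯, N < tupleNorm t

/-- The set `DI_ε(𝒯)` of the `m × n` matrices `Y` (systems of `m` linear forms in `n` variables)
over `F` for which Dirichlet's theorem can be `ε`-improved along `𝒯`. -/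
def DIMatrix (k : Type*) [Field k] {m n : ℕ} (ε : ℝ) (𝒯 : Set (Fin m ⊕ Fin n → ℕ)) :
    Set (Matrix (Fin m) (Fin n) (LaurentInv k)) :=
  {Y | ∃ t₀ : ℝ, 0 < t₀ ∧ ∀ t ∈ 𝒯, t₀ < (tupleNorm t : ℝ) →
    ∃ (p : Fin m → k[X]) (q : Fin n → k[X]), (p, q) ≠ (0, 0) ∧
      (∀ i, ‖(Y.mulVec fun j => polyEmb k (q j)) i - polyEmb k (p i)‖
        < ε / Real.exp (t (Sum.inl i))) ∧
      (∀ j, ‖polyEmb k (q j)‖ < ε * Real.exp (t (Sum.inr j)))}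

/-- The set `DI_ε(𝒯)` of vectors `y ∈ F ^ n` whose row matrix `[y₁ ⋯ y_n]` is in `DI_ε(𝒯)`. -/
def DI (k : Type*) [Field k] {n : ℕ} (ε : ℝ) (𝒯 : Set (Fin 1 ⊕ Fin n → ℕ)) :
    Set (Fin n → LaurentInv k) :=
  {y | Matrix.replicateRow (Fin 1) y ∈ DIMatrix k ε 𝒯}

/-! ### Good functions, nonplanar maps, Federer measures -/

/-- `f` is `(C, α)`-good on `U` with respect to `ν`: for every ball `B ⊆ U` with centre
in `supp ν` and every `ε > 0`,
`ν {y ∈ B : |f y| < ε} ≤ C (ε / sup_{B ∩ supp ν} |f|) ^ α ν(B)`. The right-hand side is computed in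
`[0, ∞]`; it is `∞` if `f` vanishes on `B ∩ supp ν`. -/
def IsGood {X 𝕜 : Type*} [PseudoMetricSpace X] [MeasurableSpace X] [NormedField 𝕜]
    (C α : ℝ) (f : X → 𝕜) (U : Set X) (ν : Measure X) : Prop :=
  ∀ x ∈ ν.support, ∀ r : ℝ, 0 < r → ball x r ⊆ U → ∀ ε : ℝ, 0 < ε →
    ν {y ∈ ball x r | ‖f y‖ < ε} ≤
      ENNReal.ofReal C *
        (ENNReal.ofReal ε / ⨆ y ∈ ball x r ∩ ν.support, ‖f y‖ₑ) ^ α * ν (ball x r)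

/-- `(f, ν)` is `(C, α)`-good on `U`: every linear combination
`c₀ + c₁ f₁ + ⋯ + c_n f_n` is `(C, α)`-good on `U` with respect to `ν`. -/
def IsGoodMap {X 𝕜 : Type*} [PseudoMetricSpace X] [MeasurableSpace X] [NormedField 𝕜] {n : ℕ}
    (C α : ℝ) (f : X → Fin n → 𝕜) (U : Set X) (ν : Measure X) : Prop :=
  ∀ (c₀ : 𝕜) (c : Fin n → 𝕜), IsGood C α (fun x => c₀ + ∑ i, c i * f x i) U ν

/-- `(f, ν)` is nonplanar on `U`: for every ball `B ⊆ U` with centre in `supp ν`, the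
restrictions of `1, f₁, …, f_n` to `B ∩ supp ν` are linearly independent. -/
def IsNonplanar {X 𝕜 : Type*} [PseudoMetricSpace X] [MeasurableSpace X] [NormedField 𝕜] {n : ℕ}
    (f : X → Fin n → 𝕜) (U : Set X) (ν : Measure X) : Prop :=
  ∀ x ∈ ν.support, ∀ r : ℝ, 0 < r → ball x r ⊆ U →
    LinearIndependent 𝕜
      (fun (i : Option (Fin n)) (y : ↥(ball x r ∩ ν.support)) => i.elim (1 : 𝕜) (f y))

/-- `ν` is `D`-Federer on `U`: `ν(3B) ≤ D ν(B)` for every ball `B` with centre in `supp ν`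
and `3B ⊆ U`. -/
def IsFederer {X : Type*} [PseudoMetricSpace X] [MeasurableSpace X]
    (D : ℝ) (U : Set X) (ν : Measure X) : Prop :=
  ∀ x ∈ ν.support, ∀ r : ℝ, 0 < r → ball x (3 * r) ⊆ U →
    ν (ball x (3 * r)) ≤ ENNReal.ofReal D * ν (ball x r)

end DirichletFF

end

/-!
By Dani's correspondence, `y` satisfies the `ε`-improved Dirichlet inequalities at time `t` exactly
when the lattice `Λ ^ (n + 1)`, moved by the unipotent matrix of `y` and by the diagonal flow
`(T ^ t₀, T ^ (-t₁), …, T ^ (-t_n))`, has a nonzero vector of norm less than `ε`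
(`exists_hasShortVector_of_mem_DI`). The proof bounds the proportion of such points in each small
ball by a constant less than `1`, and concludes by a density argument.

The bound is the quantitative nondivergence of Kleinbock and Margulis
(`measure_not_isMarked_le`). To every rational subspace `V` of `F ^ (n + 1)` belongs the function
`ψ V` of `x` that gives the covolume of the lattice of `V` after the move by `f x`. It is a maximum
of affine combinations of the `f i`, because there is only one row in the system of linear forms;
hence `ψ V` is good. If a point is marked, that is, has a flag of rational subspaces whose covolumes
lie in `[ε, 1]` while all subspaces compatible with the flag have covolume at least `1`, then its
lattice has no nonzero vector shorter than `ε` (`le_norm_vecMul_of_isMarked`). An induction on the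
length of chains shows that the proportion of unmarked points is at most
`C ε ^ α (D + ⋯ + D ^ (n + 2))`, provided every `ψ V` reaches the value `1` on the ball. For large
`t` this last condition follows from nonplanarity, uniformly in `V`: some affine minor either is
constant and at least `1`, or has a coefficient of absolute value at least `1` and is expanded by
`e ^ tⱼ` for some `tⱼ ≥ t₀ / n` (`exists_affine_minor`, `exists_one_le_covol_mul_flow`).

The space is ultrametric: balls that meet are nested, so covers by balls have disjoint subcovers
and no dimensional constant appears (`measure_le_of_ball_cover`). All balls used have radius `3 ^ m`
with `m` an integer, for which the Federer condition compares consecutive radii. The density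
argument (`measure_eq_zero_of_ball_proportion`) needs only outer regularity and the same covering
lemma.
-/

noncomputable section

namespace DirichletFF

/-! ### The field of Laurent series in `T⁻¹` -/

section Field

variable (k : Type*) [Field k]

lemma norm_ofSeries (a : LaurentSeries k) : ‖ofSeries k a‖ = absVal k a := rfl

lemma norm_ofSeries_of_ne_zero {a : LaurentSeries k} (ha : a ≠ 0) :
    ‖ofSeries k a‖ = Real.exp (-((HahnSeries.order a : ℤ) : ℝ)) := by
  rw [norm_ofSeries]
  exact if_neg ha

lemma norm_ofSeries_le_iff {a : LaurentSeries k} {N : ℤ} :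
    ‖ofSeries k a‖ ≤ Real.exp (-(N : ℝ)) ↔ ∀ i < N, a.coeff i = 0 := by
  by_cases ha : a = 0
  · subst ha
    simp [Real.exp_nonneg]
  rw [norm_ofSeries_of_ne_zero k ha, Real.exp_le_exp, neg_le_neg_iff, Int.cast_le]
  constructor
  · intro h i hi
    exact HahnSeries.coeff_eq_zero_of_lt_order (hi.trans_le h)
  · intro h
    by_contra! hlt
    exact ha (HahnSeries.coeff_order_eq_zero.1 (h _ hlt))

instance : IsUltrametricDist (LaurentInv k) := by
  refine IsUltrametricDist.isUltrametricDist_of_forall_norm_add_le_max_norm fun x y => ?_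
  obtain ⟨a, rfl⟩ := (ofSeries k).surjective x
  obtain ⟨b, rfl⟩ := (ofSeries k).surjective y
  rw [← map_add]
  by_cases ha : a = 0
  · simp [ha]
  by_cases hb : b = 0
  · simp [hb]
  by_cases hab : a + b = 0
  · simp [hab]
  have h := HahnSeries.min_order_le_order_add hab
  rw [norm_ofSeries_of_ne_zero k ha, norm_ofSeries_of_ne_zero k hb,
    norm_ofSeries_of_ne_zero k hab]
  rcases min_le_iff.1 h with h | h
  · exact le_max_of_le_left (Real.exp_le_exp.2 (neg_le_neg (by exact_mod_cast h)))
  · exact le_max_of_le_right (Real.exp_le_exp.2 (neg_le_neg (by exact_mod_cast h)))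

lemma norm_elemT : ‖elemT k‖ = Real.exp 1 := by
  rw [elemT, norm_ofSeries_of_ne_zero k (by simp), HahnSeries.order_single one_ne_zero]
  simp

lemma norm_elemT_zpow (m : ℤ) : ‖elemT k ^ m‖ = Real.exp m := by
  rw [norm_zpow, norm_elemT, ← Real.rpow_intCast, Real.exp_one_rpow]

lemma elemT_ne_zero : elemT k ≠ 0 := by
  rw [← norm_ne_zero_iff, norm_elemT]
  positivity

lemma norm_ofSeries_C {a : k} (ha : a ≠ 0) : ‖ofSeries k (HahnSeries.C a)‖ = 1 := by
  rw [norm_ofSeries_of_ne_zero k (by simpa using ha)]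
  simp [HahnSeries.C_apply, HahnSeries.order_single ha]

lemma polyEmb_apply (p : k[X]) :
    polyEmb k p = ∑ i ∈ Finset.range (p.natDegree + 1),
      ofSeries k (HahnSeries.C (p.coeff i)) * elemT k ^ i := by
  rw [polyEmb, coe_eval₂RingHom, eval₂_eq_sum_range]
  rfl

lemma norm_C_mul_elemT_pow {a : k} (ha : a ≠ 0) (i : ℕ) :
    ‖ofSeries k (HahnSeries.C a) * elemT k ^ i‖ = Real.exp i := by
  rw [norm_mul, norm_ofSeries_C k ha, one_mul]
  exact_mod_cast norm_elemT_zpow k i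

lemma norm_polyEmb {p : k[X]} (hp : p ≠ 0) : ‖polyEmb k p‖ = Real.exp p.natDegree := by
  rw [polyEmb_apply, Finset.sum_range_succ]
  have hlead := norm_C_mul_elemT_pow k (leadingCoeff_ne_zero.2 hp) p.natDegree
  rw [leadingCoeff] at hlead
  have hlt : ‖∑ i ∈ Finset.range p.natDegree,
      ofSeries k (HahnSeries.C (p.coeff i)) * elemT k ^ i‖ < Real.exp p.natDegree := by
    rcases (Finset.range p.natDegree).eq_empty_or_nonempty with h | h
    · rw [h]
      simp [Real.exp_pos]
    · obtain ⟨i, hi, hle⟩ := IsUltrametricDist.exists_norm_finsetSum_le_of_nonempty h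
        (fun i => ofSeries k (HahnSeries.C (p.coeff i)) * elemT k ^ i)
      refine hle.trans_lt ?_
      by_cases h0 : p.coeff i = 0
      · simp [h0, Real.exp_pos]
      · rw [norm_C_mul_elemT_pow k h0]
        exact Real.exp_lt_exp.2 (by exact_mod_cast Finset.mem_range.1 hi)
  rw [IsUltrametricDist.norm_add_eq_max_of_norm_ne_norm (by rw [hlead]; exact hlt.ne), hlead]
  exact max_eq_right hlt.le

lemma polyEmb_injective : Function.Injective (polyEmb k) := by
  rw [injective_iff_map_eq_zero]
  intro p hp
  by_contra h
  have := norm_polyEmb k h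
  rw [hp, norm_zero] at this
  exact (Real.exp_pos _).ne this

lemma exists_norm_eq_exp {x : LaurentInv k} (hx : x ∈ (polyEmb k).range) (h0 : x ≠ 0) :
    ∃ N : ℕ, ‖x‖ = Real.exp N := by
  obtain ⟨p, rfl⟩ := hx
  exact ⟨p.natDegree, norm_polyEmb k fun h => h0 (h ▸ (polyEmb k).map_zero)⟩

lemma one_le_norm_of_mem_range {x : LaurentInv k} (hx : x ∈ (polyEmb k).range) (h0 : x ≠ 0) :
    1 ≤ ‖x‖ := by
  obtain ⟨N, hN⟩ := exists_norm_eq_exp k hx h0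
  rw [hN]
  exact Real.one_le_exp (Nat.cast_nonneg N)

/-- The closed unit ball is the image of the compact space `ℕ → k` of coefficient sequences. -/
lemma isCompact_closedBall_zero_one [Finite k] :
    IsCompact (closedBall (0 : LaurentInv k) 1) := by
  let _ : TopologicalSpace k := ⊥
  have : DiscreteTopology k := ⟨rfl⟩
  let φ : (ℕ → k) → LaurentInv k := fun a =>
    ofSeries k (HahnSeries.ofPowerSeries ℤ k (PowerSeries.mk a))
  have hsub : ∀ a b, φ a - φ b = φ (a - b) := fun a b => by
    simp only [φ, ← map_sub]
    rfl
  have hle : ∀ (a : ℕ → k) (N : ℕ), (∀ i < N, a i = 0) → ‖φ a‖ ≤ Real.exp (-(N : ℝ)) := by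
    intro a N h
    rw [← Int.cast_natCast (R := ℝ) N, norm_ofSeries_le_iff]
    intro i hi
    rcases le_or_gt 0 i with h0 | h0
    · lift i to ℕ using h0
      rw [HahnSeries.ofPowerSeries_apply_coeff, PowerSeries.coeff_mk]
      exact h i (by exact_mod_cast hi)
    · rw [HahnSeries.ofPowerSeries_apply]
      refine HahnSeries.embDomain_of_notMem_range ?_
      rintro ⟨j, rfl⟩
      simp at h0
      omega
  have hcont : Continuous φ := by
    rw [continuous_iff_continuousAt]
    intro a
    rw [ContinuousAt, Metric.tendsto_nhds]
    intro ε hε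
    obtain ⟨N, hN⟩ := exists_nat_gt (-Real.log ε)
    have hev : ∀ᶠ b in nhds a, ∀ i ∈ Finset.range N, b i = a i := by
      rw [Filter.eventually_all_finset]
      intro i _
      exact (continuous_apply i).continuousAt.eventually
        ((isOpen_discrete {a i}).mem_nhds rfl)
    filter_upwards [hev] with b hb
    rw [dist_eq_norm, hsub]
    refine (hle _ N fun i hi => by simp [hb i (Finset.mem_range.2 hi)]).trans_lt ?_
    rw [← Real.lt_log_iff_exp_lt hε]
    linarith
  have himg : φ '' Set.univ = closedBall 0 1 := by
    ext x
    simp only [Set.image_univ, Set.mem_range, mem_closedBall, dist_zero_right]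
    constructor
    · rintro ⟨a, rfl⟩
      simpa using hle a 0 (by simp)
    · intro hx
      obtain ⟨a, rfl⟩ := (ofSeries k).surjective x
      have ha := (norm_ofSeries_le_iff k (N := 0)).1 (by simpa using hx)
      refine ⟨fun i => a.coeff i, ?_⟩
      simp only [φ]
      congr 1
      ext i
      rcases le_or_gt 0 i with h0 | h0
      · lift i to ℕ using h0
        rw [HahnSeries.ofPowerSeries_apply_coeff, PowerSeries.coeff_mk]
      · rw [ha i h0, HahnSeries.ofPowerSeries_apply]
        refine HahnSeries.embDomain_of_notMem_range ?_
        rintro ⟨j, rfl⟩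
        simp at h0
        omega
  rw [← himg]
  exact isCompact_univ.image hcont

instance [Finite k] : ProperSpace (LaurentInv k) := by
  refine ProperSpace.of_seq_closedBall (l := Filter.atTop) (x := 0)
    (r := fun N : ℕ => Real.exp N)
    (Real.tendsto_exp_atTop.comp tendsto_natCast_atTop_atTop) (Filter.Eventually.of_forall ?_)
  intro N
  have h := (isCompact_closedBall_zero_one k).image (continuous_const_mul (elemT k ^ (N : ℤ)))
  refine h.of_isClosed_subset isClosed_closedBall fun x hx => ?_
  refine ⟨elemT k ^ (-(N : ℤ)) * x, ?_, ?_⟩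
  · rw [mem_closedBall, dist_zero_right, norm_mul, norm_elemT_zpow]
    have hx' : ‖x‖ ≤ Real.exp N := by simpa using hx
    calc _ ≤ Real.exp ((-(N : ℤ) : ℤ) : ℝ) * Real.exp N := by gcongr
      _ = 1 := by rw [← Real.exp_add]; simp
  · simp only
    rw [← mul_assoc, ← zpow_add₀ (elemT_ne_zero k)]
    simp

end Field

/-! ### Measures on ultrametric spaces -/

section Ultrametric

open scoped ENNReal

variable {X : Type*} [PseudoMetricSpace X] [IsUltrametricDist X]

lemma three_zpow_pos (m : ℤ) : (0 : ℝ) < 3 ^ m := by positivity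

omit [IsUltrametricDist X] in
lemma ball_three_zpow_mono (x : X) {l m : ℤ} (h : l ≤ m) :
    ball x ((3 : ℝ) ^ l) ⊆ ball x (3 ^ m) :=
  ball_subset_ball (zpow_le_zpow_right₀ (by norm_num) h)

lemma ball_subset_of_mem {x y z : X} {l m : ℤ} (hx : z ∈ ball x ((3 : ℝ) ^ l))
    (hy : z ∈ ball y ((3 : ℝ) ^ m)) (h : l ≤ m) : ball x ((3 : ℝ) ^ l) ⊆ ball y (3 ^ m) := by
  rw [IsUltrametricDist.ball_eq_of_mem hx, IsUltrametricDist.ball_eq_of_mem hy]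
  exact ball_three_zpow_mono z h

variable [MeasurableSpace X] [OpensMeasurableSpace X] [SecondCountableTopology X]

/-- In an ultrametric space balls that meet are nested, so a cover by balls of bounded radii has a
disjoint subcover, made of its maximal balls: a local bound for the measure of `E` sums up to a
global one without any loss of multiplicity. -/
lemma measure_le_of_ball_cover (ν : Measure X) (E V : Set X) (l : X → ℤ) (M : ℤ) (c : ℝ≥0∞)
    (hM : ∀ x ∈ E, l x ≤ M) (hV : ∀ x ∈ E, ball x (3 ^ l x) ⊆ V)
    (h : ∀ x ∈ E, ν (E ∩ ball x (3 ^ l x)) ≤ c * ν (ball x (3 ^ l x))) :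
    ν E ≤ c * ν V := by
  have hex : ∀ x ∈ E, ∃ y ∈ E, x ∈ ball y (3 ^ l y) ∧
      ∀ z ∈ E, x ∈ ball z (3 ^ l z) → l z ≤ l y := by
    intro x hx
    obtain ⟨j, ⟨y, hy, hxy, rfl⟩, hmax⟩ := Int.exists_greatest_of_bdd
      (P := fun j => ∃ y ∈ E, x ∈ ball y (3 ^ l y) ∧ l y = j)
      ⟨M, by rintro j ⟨y, hy, -, rfl⟩; exact hM y hy⟩
      ⟨_, x, hx, mem_ball_self (three_zpow_pos _), rfl⟩
    exact ⟨y, hy, hxy, fun z hz hxz => hmax _ ⟨z, hz, hxz, rfl⟩⟩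
  choose! y hyE hxy hmax using hex
  let 𝓑 : Set (Set X) := (fun x => ball (y x) ((3 : ℝ) ^ l (y x))) '' E
  have hdisj : 𝓑.PairwiseDisjoint id := by
    rintro _ ⟨x, hx, rfl⟩ _ ⟨x', hx', rfl⟩ hne
    rw [Function.onFun, Set.disjoint_left]
    intro z hz hz'
    refine hne ?_
    simp only [id] at hz hz' ⊢
    have key : l (y x) = l (y x') := by
      rcases le_total (l (y x)) (l (y x')) with hle | hle
      · exact le_antisymm hle
          (hmax x hx _ (hyE x' hx') (ball_subset_of_mem hz hz' hle (hxy x hx)))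
      · exact le_antisymm
          (hmax x' hx' _ (hyE x hx) (ball_subset_of_mem hz' hz hle (hxy x' hx'))) hle
    exact (ball_subset_of_mem hz hz' key.le).antisymm (ball_subset_of_mem hz' hz key.ge)
  have hcount : 𝓑.Countable := by
    refine hdisj.countable_of_isOpen ?_ ?_
    · rintro _ ⟨x, hx, rfl⟩
      exact isOpen_ball
    · rintro _ ⟨x, hx, rfl⟩
      exact ⟨y x, mem_ball_self (three_zpow_pos _)⟩
  calc ν E ≤ ν (⋃ b ∈ 𝓑, E ∩ b) := by
        refine measure_mono fun x hx => ?_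
        exact Set.mem_biUnion (Set.mem_image_of_mem _ hx) ⟨hx, hxy x hx⟩
    _ ≤ ∑' b : 𝓑, ν (E ∩ b) := measure_biUnion_le ν hcount _
    _ ≤ ∑' b : 𝓑, c * ν b := by
        refine ENNReal.tsum_le_tsum ?_
        rintro ⟨_, x, hx, rfl⟩
        exact h _ (hyE x hx)
    _ = c * ν (⋃ b ∈ 𝓑, b) := by
        rw [ENNReal.tsum_mul_left]
        congr 1
        refine (measure_biUnion (f := id) hcount hdisj ?_).symm
        rintro _ ⟨x, hx, rfl⟩
        exact measurableSet_ball
    _ ≤ c * ν V := by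
        gcongr
        refine Set.iUnion₂_subset ?_
        rintro _ ⟨x, hx, rfl⟩
        exact hV _ (hyE x hx)

/-- A set of finite measure that fills at most a fixed proportion `c < 1` of all small balls around
its points in the support is null. -/
lemma measure_eq_zero_of_ball_proportion 
    (ν : Measure X) [ν.OuterRegular] (A : Set X) (hA : ν A ≠ ∞) (c : ℝ≥0∞) (hc : c < 1)
    (h : ∀ x ∈ A ∩ ν.support, ∃ M : ℤ, ∀ m ≤ M,
      ν (A ∩ ball x (3 ^ m)) ≤ c * ν (ball x (3 ^ m))) :
    ν A = 0 := by
  have hA' : ν (A ∩ ν.support) = ν A := by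
    refine measure_inter_conull ?_
    exact Measure.measure_compl_support
  have key : ν A ≤ c * ν A := by
    have hle : ∀ V ⊇ A, IsOpen V → ν A ≤ c * ν V := by
      intro V hAV hVo
      have hex : ∀ x ∈ A ∩ ν.support, ∃ l : ℤ, l ≤ 0 ∧ ball x ((3 : ℝ) ^ l) ⊆ V ∧
          ν (A ∩ ball x (3 ^ l)) ≤ c * ν (ball x (3 ^ l)) := by
        intro x hx
        obtain ⟨M, hM⟩ := h x hx
        obtain ⟨r, hr, hrV⟩ := Metric.isOpen_iff.1 hVo x (hAV hx.1)
        obtain ⟨N, hN⟩ := exists_pow_lt_of_lt_one hr (show (3⁻¹ : ℝ) < 1 by norm_num)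
        refine ⟨min (min 0 M) (-N), by omega, ?_, hM _ (by omega)⟩
        refine (ball_three_zpow_mono x (min_le_right _ _)).trans (Set.Subset.trans ?_ hrV)
        refine ball_subset_ball (le_trans (le_of_eq ?_) hN.le)
        rw [zpow_neg, zpow_natCast, inv_pow]
      choose! l hl0 hlV hl using hex
      rw [← hA']
      refine measure_le_of_ball_cover ν _ V l 0 c hl0 hlV fun x hx => ?_
      exact (measure_mono (Set.inter_subset_inter_left _ Set.inter_subset_left)).trans (hl x hx)
    refine ENNReal.le_of_forall_pos_le_add fun η hη _ => ?_
    obtain ⟨V, hAV, hVo, hV⟩ := A.exists_isOpen_le_add ν (ε := η) (by simpa using hη.ne')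
    calc ν A ≤ c * ν V := hle V hAV hVo
      _ ≤ c * (ν A + η) := by gcongr
      _ ≤ c * ν A + η := by
        rw [mul_add]
        gcongr
        exact mul_le_of_le_one_left' hc.le
  by_contra h0
  have : c * ν A < 1 * ν A := ENNReal.mul_lt_mul_left h0 hA hc
  rw [one_mul] at this
  exact absurd key this.not_ge

/-- `x` is marked for the family `P` of functions `ψ s`: there is a finite chain in `P` on which the
values at `x` lie in `[ε, 1]`, whereas they are at least `1` on all other elements of `P` that are
comparable with the whole chain. -/
def IsMarked {S : Type*} [PartialOrder S] (P : Set S) (ψ : S → X → ℝ) (ε : ℝ) (x : X) : Prop :=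
  ∃ c : Finset S, (c : Set S) ⊆ P ∧ IsChain (· ≤ ·) (c : Set S) ∧
    (∀ s ∈ c, ε ≤ ψ s x ∧ ψ s x ≤ 1) ∧
    ∀ s ∈ P, s ∉ c → (∀ s' ∈ c, s ≤ s' ∨ s' ≤ s) → 1 ≤ ψ s x

omit [PseudoMetricSpace X] [IsUltrametricDist X] [MeasurableSpace X] [OpensMeasurableSpace X]
  [SecondCountableTopology X] in
lemma setOf_not_isMarked_empty {S : Type*} [PartialOrder S] (B : Set X) (ψ : S → X → ℝ) (ε : ℝ) :
    {x ∈ B | ¬ IsMarked ∅ ψ ε x} = ∅ :=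
  Set.eq_empty_of_forall_notMem fun _ hx => hx.2 ⟨∅, by simp, by simp, by simp, by simp⟩

/-- The constant `D + D² + ⋯ + D ^ k`, in the form in which the induction on the length of
chains produces it. -/
def markedConst (D : ℝ≥0∞) : ℕ → ℝ≥0∞
  | 0 => 0
  | k + 1 => (markedConst D k + 1) * D

/-- Quantitative nondivergence. If every `ψ s` reaches the value `1` on the support in a ball `B`,
and `{ψ s < ε}` has proportion at most `a` in every smaller ball with that property, then the points
of `B` that are not marked have proportion at most `a (D + ⋯ + D ^ k)`, where `k` bounds the length
of chains in `P`. -/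
lemma measure_not_isMarked_le 
    {S : Type*} [PartialOrder S] (ν : Measure X) (ψ : S → X → ℝ) (ε : ℝ) (a D : ℝ≥0∞) (k : ℕ) :
    ∀ (P : Set S) (x₀ : X) (m : ℤ),
    (∀ c : Finset S, (c : Set S) ⊆ P → IsChain (· ≤ ·) (c : Set S) → c.card ≤ k) →
    (∀ s ∈ P, ∃ x ∈ ball x₀ (3 ^ m) ∩ ν.support, 1 ≤ ψ s x) →
    (∀ s ∈ P, ContinuousOn (ψ s) (ball x₀ (3 ^ m))) →
    (∀ s ∈ P, ∀ x ∈ ν.support, ∀ l : ℤ, ball x (3 ^ l) ⊆ ball x₀ (3 ^ m) →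
      (∃ y ∈ ball x (3 ^ l) ∩ ν.support, 1 ≤ ψ s y) →
      ν {y ∈ ball x (3 ^ l) | ψ s y < ε} ≤ a * ν (ball x (3 ^ l))) →
    (∀ x ∈ ν.support, ∀ l : ℤ, ball x (3 ^ (l + 1)) ⊆ ball x₀ (3 ^ m) →
      ν (ball x (3 ^ (l + 1))) ≤ D * ν (ball x (3 ^ l))) →
    ν {x ∈ ball x₀ (3 ^ m) | ¬ IsMarked P ψ ε x} ≤
      a * markedConst D k * ν (ball x₀ (3 ^ m)) := by
  induction k with
  | zero =>
    intro P x₀ m hchain _ _ _ _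
    have hP : P = ∅ := by
      refine Set.eq_empty_of_forall_notMem fun s hs => ?_
      simpa using hchain {s} (by simpa using hs) (by simp)
    rw [hP, setOf_not_isMarked_empty, measure_empty]
    exact zero_le
  | succ k ih =>
    intro P x₀ m hchain hone hcont hgood hfed
    rcases P.eq_empty_or_nonempty with hP | ⟨s₀, -⟩
    · rw [hP, setOf_not_isMarked_empty, measure_empty]
      exact zero_le
    have : Nonempty S := ⟨s₀⟩
    set B := ball x₀ ((3 : ℝ) ^ m) with hB
    set E := {x ∈ B | ¬ IsMarked P ψ ε x} with hE
    have hE' : ν (E ∩ ν.support) = ν E := measure_inter_conull Measure.measure_compl_support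
    -- The largest ball around `x` on which some `ψ s` stays below `1`.
    have hex : ∀ x ∈ E ∩ ν.support, ∃ (l : ℤ) (s : S), s ∈ P ∧ l < m ∧
        (∀ y ∈ ball x (3 ^ l) ∩ ν.support, ψ s y < 1) ∧
        ∀ s' ∈ P, ∃ y ∈ ball x (3 ^ (l + 1)) ∩ ν.support, 1 ≤ ψ s' y := by
      rintro x ⟨⟨hxB, hxm⟩, hxs⟩
      have h0 : ∃ s ∈ P, ψ s x < 1 := by
        by_contra! h0
        exact hxm ⟨∅, by simp, by simp, by simp, fun s hs _ _ => h0 s hs⟩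
      have hlt : ∀ l : ℤ, (∃ s ∈ P, ∀ y ∈ ball x (3 ^ l) ∩ ν.support, ψ s y < 1) → l < m := by
        rintro l ⟨s, hs, hl⟩
        by_contra! hml
        obtain ⟨y, ⟨hy, hys⟩, hy1⟩ := hone s hs
        refine (hl y ⟨?_, hys⟩).not_ge hy1
        exact ball_subset_of_mem hxB (mem_ball_self (three_zpow_pos _)) hml hy
      obtain ⟨l, ⟨s, hs, hl⟩, hmax⟩ := Int.exists_greatest_of_bdd
        (P := fun l : ℤ => ∃ s ∈ P, ∀ y ∈ ball x (3 ^ l) ∩ ν.support, ψ s y < 1)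
        ⟨m, fun l hl => (hlt l hl).le⟩ (by
          obtain ⟨s, hs, hsx⟩ := h0
          have hev : ∀ᶠ y in nhds x, ψ s y < 1 :=
            ((hcont s hs).continuousAt (isOpen_ball.mem_nhds hxB)).eventually_lt_const hsx
          obtain ⟨r, hr, hrlt⟩ := Metric.eventually_nhds_iff_ball.1 hev
          obtain ⟨N, hN⟩ := exists_pow_lt_of_lt_one hr (show (3⁻¹ : ℝ) < 1 by norm_num)
          refine ⟨-N, s, hs, fun y hy => hrlt y (ball_subset_ball ?_ hy.1)⟩
          rw [zpow_neg, zpow_natCast, ← inv_pow]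
          exact hN.le)
      refine ⟨l, s, hs, hlt l ⟨s, hs, hl⟩, hl, fun s' hs' => ?_⟩
      by_contra! hcon
      have := hmax (l + 1) ⟨s', hs', hcon⟩
      omega
    choose! l s hsP hlm hlt hup using hex
    rw [← hE']
    refine measure_le_of_ball_cover ν _ B l m _ (fun x hx => (hlm x hx).le) (fun x hx => ?_)
      fun x hx => ?_
    · exact ball_subset_of_mem (mem_ball_self (three_zpow_pos _)) hx.1.1 (hlm x hx).le
    have hxs : x ∈ ν.support := hx.2
    have hsub : ball x ((3 : ℝ) ^ (l x + 1)) ⊆ B :=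
      ball_subset_of_mem (mem_ball_self (three_zpow_pos _)) hx.1.1 (hlm x hx)
    -- Induct over the elements of `P` that are comparable with `s x`.
    set P' : Set S := {s' ∈ P | s' ≠ s x ∧ (s' ≤ s x ∨ s x ≤ s')} with hP'
    have hind := ih P' x (l x + 1) (by
        intro c hc hcc
        classical
        have hnot : s x ∉ c := fun hmem => (hc hmem).2.1 rfl
        have hins := hchain (insert (s x) c) (by
          rw [Finset.coe_insert, Set.insert_subset_iff]
          exact ⟨hsP x hx, fun s' hs' => (hc hs').1⟩) (by
          rw [Finset.coe_insert]
          exact hcc.insert fun s' hs' _ => (hc hs').2.2.symm)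
        rw [Finset.card_insert_of_notMem hnot] at hins
        omega)
      (fun s' hs' => hup x hx s' hs'.1)
      (fun s' hs' => (hcont s' hs'.1).mono hsub)
      (fun s' hs' z hz j hj => hgood s' hs'.1 z hz j (hj.trans hsub))
      (fun z hz j hj => hfed z hz j (hj.trans hsub))
    have hbad := hgood (s x) (hsP x hx) x hxs (l x + 1) hsub (hup x hx _ (hsP x hx))
    have hcover : E ∩ ν.support ∩ ball x (3 ^ l x) ⊆
        {y ∈ ball x (3 ^ (l x + 1)) | ¬ IsMarked P' ψ ε y} ∪
          {y ∈ ball x (3 ^ (l x + 1)) | ψ (s x) y < ε} := by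
      rintro y ⟨⟨⟨hyB, hym⟩, hys⟩, hyx⟩
      have hyx' : y ∈ ball x ((3 : ℝ) ^ (l x + 1)) := ball_three_zpow_mono x (by omega) hyx
      by_contra! hcon
      simp only [Set.mem_union, Set.mem_ofPred_eq, not_or, not_and, not_not, not_lt] at hcon
      obtain ⟨c, hcP, hcc, hc1, hc2⟩ := hcon.1 hyx'
      classical
      refine hym ⟨insert (s x) c, ?_, ?_, ?_, ?_⟩
      · rw [Finset.coe_insert, Set.insert_subset_iff]
        exact ⟨hsP x hx, fun s' hs' => (hcP hs').1⟩
      · rw [Finset.coe_insert]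
        exact hcc.insert fun s' hs' _ => (hcP hs').2.2.symm
      · intro s' hs'
        rcases Finset.mem_insert.1 hs' with rfl | hs'
        · exact ⟨hcon.2 hyx', (hlt x hx y ⟨hyx, hys⟩).le⟩
        · exact hc1 s' hs'
      · intro s' hs' hnot hcomp
        rw [Finset.mem_insert, not_or] at hnot
        exact hc2 s' ⟨hs', hnot.1, hcomp _ (Finset.mem_insert_self _ _)⟩ hnot.2
          fun s'' hs'' => hcomp s'' (Finset.mem_insert_of_mem hs'')
    calc ν (E ∩ ν.support ∩ ball x (3 ^ l x))
        ≤ a * markedConst D k * ν (ball x (3 ^ (l x + 1))) +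
          a * ν (ball x (3 ^ (l x + 1))) :=
          (measure_mono hcover).trans ((measure_union_le _ _).trans (add_le_add hind hbad))
      _ = a * (markedConst D k + 1) * ν (ball x (3 ^ (l x + 1))) := by ring
      _ ≤ a * (markedConst D k + 1) * (D * ν (ball x (3 ^ l x))) := by
          gcongr
          exact hfed x hxs (l x) hsub
      _ = a * markedConst D (k + 1) * ν (ball x (3 ^ l x)) := by
          rw [markedConst]
          ring

lemma markedConst_ne_top {D : ℝ≥0∞} (hD : D ≠ ∞) (k : ℕ) : markedConst D k ≠ ∞ := by
  induction k with
  | zero => simp [markedConst]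
  | succ k ih => exact ENNReal.mul_ne_top (ENNReal.add_ne_top.2 ⟨ih, ENNReal.one_ne_top⟩) hD

end Ultrametric

/-! ### Covolumes of tuples of vectors -/

section Covolume

open Matrix

variable {K : Type*} [NormedField K] {ι : Type*}

/-- The maximal minors of an `r × ι` matrix. A minor is indexed by an arbitrary map from the rows
to the columns, so that every minor occurs up to sign once for each order of its columns, along with
zeros from the maps that are not injective. -/
def minors {r : ℕ} (v : Matrix (Fin r) ι K) : (Fin r → ι) → K :=
  fun I => (v.submatrix id I).det

lemma minors_mul {r : ℕ} (A : Matrix (Fin r) (Fin r) K) (v : Matrix (Fin r) ι K) :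
    minors (A * v) = A.det • minors v := by
  ext I
  simp only [minors, Pi.smul_apply, smul_eq_mul, ← det_mul]
  rfl

lemma minors_apply_eq_zero {r : ℕ} (v : Matrix (Fin r) ι K) {I : Fin r → ι}
    (hI : ¬ Function.Injective I) : minors v I = 0 := by
  simp only [Function.Injective, not_forall] at hI
  obtain ⟨a, b, hab, hne⟩ := hI
  exact det_zero_of_column_eq hne fun i => by simp [hab]

lemma minors_mem {R : Subring K} {r : ℕ} {v : Matrix (Fin r) ι K} (h : ∀ i j, v i j ∈ R)
    (I : Fin r → ι) :
    minors v I ∈ R := by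
  rw [minors, det_apply']
  refine sum_mem fun σ _ => mul_mem ?_ (prod_mem fun i _ => h _ _)
  exact intCast_mem R _

variable [Fintype ι]

/-- The covolume of the lattice spanned by the rows of `v`: the supremum norm of the exterior
product of the rows. -/
def covol {r : ℕ} (v : Matrix (Fin r) ι K) : ℝ := ‖minors v‖

lemma covol_mul {r : ℕ} (A : Matrix (Fin r) (Fin r) K) (v : Matrix (Fin r) ι K) :
    covol (A * v) = ‖A.det‖ * covol v := by
  rw [covol, minors_mul, norm_smul, covol]

lemma vecCons_mul {r : ℕ} (w : ι → K) (v : Matrix (Fin r) ι K) (N : Matrix ι ι K) :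
    of (vecCons w v) * N = of (vecCons (w ᵥ* N) (v * N)) := by
  ext i j
  induction i using Fin.cases <;> rfl

lemma covol_le_one_of_rows_eq_zero (v : Matrix (Fin 0) ι K) : covol v ≤ 1 := by
  refine (pi_norm_le_iff_of_nonneg zero_le_one).2 fun I => ?_
  simp [minors]

/-- The Hadamard inequality, by Laplace expansion along the first row. -/
lemma covol_cons_le [IsUltrametricDist K] {r : ℕ} (w : ι → K) (v : Matrix (Fin r) ι K) :
    covol (of (vecCons w v)) ≤ ‖w‖ * covol v := by
  refine (pi_norm_le_iff_of_nonneg (mul_nonneg (norm_nonneg _) (norm_nonneg _))).2 fun I => ?_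
  rw [minors, det_succ_row_zero]
  refine IsUltrametricDist.norm_sum_le_of_forall_le_of_nonneg
    (mul_nonneg (norm_nonneg _) (norm_nonneg _)) fun j _ => ?_
  rw [norm_mul, norm_mul, norm_pow, norm_neg, norm_one, one_pow, one_mul]
  gcongr
  · exact norm_le_pi_norm w (I j)
  · exact norm_le_pi_norm (minors v) (fun i => I (j.succAbove i))

/-- A matrix with independent rows has a nonzero maximal minor: expand `det (v * B) = 1` for a right
inverse `B` of `v` multilinearly in the columns. -/
lemma minors_ne_zero {r : ℕ} {v : Matrix (Fin r) ι K} (hv : LinearIndependent K v.row) :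
    minors v ≠ 0 := by
  classical
  intro h0
  obtain ⟨g, hg⟩ := LinearMap.exists_leftInverse_of_injective v.vecMulLinear
    (LinearMap.ker_eq_bot.2 (vecMul_injective_iff.2 hv))
  set B : Matrix ι (Fin r) K := of fun i j => g (Pi.single i 1) j with hB
  have hgB : ∀ x, g x = x ᵥ* B := by
    intro x
    ext j
    conv_lhs => rw [← Finset.univ_sum_single x]
    simp only [map_sum, Finset.sum_apply, vecMul, dotProduct, hB, of_apply]
    refine Finset.sum_congr rfl fun i _ => ?_
    rw [← mul_one (x i), ← smul_eq_mul (x i) 1, Pi.single_smul, map_smul]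
    simp
  have hvB : v * B = 1 := by
    refine Matrix.ext fun i j => ?_
    have := congrFun (LinearMap.congr_fun hg (Pi.single i 1)) j
    simp only [LinearMap.comp_apply, hgB, vecMulLinear_apply, LinearMap.id_apply,
      single_one_vecMul] at this
    rw [one_apply]
    refine Eq.trans this ?_
    simp [Pi.single_apply, eq_comm]
  have hdet : (v * B).det = ∑ I : Fin r → ι, (∏ b, B (I b) b) * minors v I := by
    rw [← det_transpose]
    have : (v * B)ᵀ = fun b => ∑ i, B i b • vᵀ i := by
      ext b a
      simp [mul_apply, transpose_apply, Finset.sum_apply, mul_comm]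
    change (detRowAlternating (R := K)).toMultilinearMap _ = _
    rw [this, MultilinearMap.map_sum]
    refine Finset.sum_congr rfl fun I _ => ?_
    rw [MultilinearMap.map_smul_univ, smul_eq_mul, minors, ← det_transpose]
    rfl
  rw [hvB, det_one, h0] at hdet
  simp at hdet

lemma covol_pos {r : ℕ} {v : Matrix (Fin r) ι K} (hv : LinearIndependent K v.row) :
    0 < covol v :=
  norm_pos_iff.2 (minors_ne_zero hv)

lemma exists_norm_minors_eq_covol {r : ℕ} {v : Matrix (Fin r) ι K} (hv : minors v ≠ 0) :
    ∃ I, minors v I ≠ 0 ∧ ‖minors v I‖ = covol v := by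
  obtain ⟨I₀, hI₀⟩ := Function.ne_iff.1 hv
  have : Nonempty (Fin r → ι) := ⟨I₀⟩
  obtain ⟨I, hI⟩ := Finite.exists_max fun I => ‖minors v I‖
  refine ⟨I, norm_pos_iff.1 ((norm_pos_iff.2 hI₀).trans_le (hI I₀)), ?_⟩
  exact (norm_le_pi_norm (minors v) I).antisymm
    ((pi_norm_le_iff_of_nonneg (norm_nonneg _)).2 hI)

/-! ### Rational subspaces and their bases of least covolume -/

/-- The rows of `v` form a basis of `V` and have entries in the subring `R`. -/
structure IsIntBasis {ι : Type*} (R : Subring K) (V : Submodule K (ι → K)) {r : ℕ}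
    (v : Matrix (Fin r) ι K) : Prop where
  mem : ∀ i j, v i j ∈ R
  linearIndependent : LinearIndependent K v.row
  span : Submodule.span K (Set.range v.row) = V

/-- A subspace of `K ^ ι` that has a basis with entries in `R`. -/
def IsRational {ι : Type*} (R : Subring K) (V : Submodule K (ι → K)) : Prop :=
  ∃ v : Matrix (Fin (Module.finrank K V)) ι K, IsIntBasis R V v

variable {ι : Type*} {R : Subring K} {V : Submodule K (ι → K)}

lemma IsIntBasis.finrank_eq {r : ℕ} {v : Matrix (Fin r) ι K} (h : IsIntBasis R V v) :
    Module.finrank K V = r := by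
  rw [← h.span, finrank_span_eq_card h.linearIndependent, Fintype.card_fin]

lemma IsIntBasis.isRational {r : ℕ} {v : Matrix (Fin r) ι K} (h : IsIntBasis R V v) :
    IsRational R V := by
  obtain rfl := h.finrank_eq
  exact ⟨v, h⟩

lemma isIntBasis_bot (v : Matrix (Fin 0) ι K) : IsIntBasis R ⊥ v :=
  ⟨fun i => i.elim0, linearIndependent_empty_type, by simp⟩

lemma IsIntBasis.cons {r : ℕ} {v : Matrix (Fin r) ι K} (h : IsIntBasis R V v) {w : ι → K}
    (hw : ∀ i, w i ∈ R) (hwV : w ∉ V) :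
    IsIntBasis R (V ⊔ Submodule.span K {w}) (of (vecCons w v)) := by
  refine ⟨fun i => ?_, ?_, ?_⟩
  · induction i using Fin.cases with
    | zero => exact hw
    | succ i => exact h.mem i
  · refine linearIndependent_finCons.2 ⟨h.linearIndependent, ?_⟩
    rw [← h.span] at hwV
    exact hwV
  · have : Set.range (of (vecCons w v)).row = {w} ∪ Set.range v.row :=
      Matrix.range_cons w v
    rw [this, Submodule.span_union, h.span, sup_comm]

variable [Fintype ι]

/-- The covolumes of integral bases are discrete, so one of them is least. -/
lemma exists_isIntBasis_forall_covol_le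
    (hR : ∀ x ∈ R, x ≠ 0 → ∃ N : ℕ, ‖x‖ = Real.exp N) (hV : IsRational R V) :
    ∃ v : Matrix (Fin (Module.finrank K V)) ι K, IsIntBasis R V v ∧
      ∀ v' : Matrix (Fin (Module.finrank K V)) ι K, IsIntBasis R V v' → covol v ≤ covol v' := by
  classical
  have hex : ∀ v : Matrix (Fin (Module.finrank K V)) ι K, IsIntBasis R V v →
      ∃ N : ℕ, covol v = Real.exp N := by
    intro v hv
    obtain ⟨I, hI0, hI⟩ := exists_norm_minors_eq_covol (minors_ne_zero hv.linearIndependent)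
    rw [← hI]
    exact hR _ (minors_mem hv.mem I) hI0
  have hN : ∃ (N : ℕ) (v : Matrix (Fin (Module.finrank K V)) ι K),
      IsIntBasis R V v ∧ covol v = Real.exp N := by
    obtain ⟨v, hv⟩ := hV
    obtain ⟨N, h⟩ := hex v hv
    exact ⟨N, v, hv, h⟩
  obtain ⟨v, hv, h⟩ := Nat.find_spec hN
  refine ⟨v, hv, fun v' hv' => ?_⟩
  obtain ⟨N', h'⟩ := hex v' hv'
  rw [h, h', Real.exp_le_exp, Nat.cast_le]
  exact Nat.find_min' hN ⟨v', hv', h'⟩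

variable (R V) in
/-- A basis of the rational subspace `V` with entries in `R` and with the least covolume. For the
ring `R` of integers it is a basis of the lattice `V ∩ R ^ ι`. -/
def minBasis : Matrix (Fin (Module.finrank K V)) ι K :=
  Classical.epsilon fun v => IsIntBasis R V v ∧
    ∀ v' : Matrix (Fin (Module.finrank K V)) ι K, IsIntBasis R V v' → covol v ≤ covol v'

lemma minBasis_spec (hR : ∀ x ∈ R, x ≠ 0 → ∃ N : ℕ, ‖x‖ = Real.exp N) (hV : IsRational R V) :
    IsIntBasis R V (minBasis R V) ∧
      ∀ v' : Matrix (Fin (Module.finrank K V)) ι K, IsIntBasis R V v' →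
        covol (minBasis R V) ≤ covol v' :=
  Classical.epsilon_spec (exists_isIntBasis_forall_covol_le hR hV)

/-- The covolumes of two bases of `V` keep their ratio under any linear map, so the basis of least
covolume still has the least covolume after a linear map is applied. -/
lemma covol_minBasis_mul_le (hR : ∀ x ∈ R, x ≠ 0 → ∃ N : ℕ, ‖x‖ = Real.exp N) {r : ℕ}
    {v : Matrix (Fin r) ι K} (hv : IsIntBasis R V v) (N : Matrix ι ι K) :
    covol (minBasis R V * N) ≤ covol (v * N) := by
  obtain rfl := hv.finrank_eq
  obtain ⟨hb, hmin⟩ := minBasis_spec hR hv.isRational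
  set b := minBasis R V
  have hmem : ∀ i, ∃ c : Fin (Module.finrank K V) → K, ∑ j, c j • b j = v i := by
    intro i
    refine (Submodule.mem_span_range_iff_exists_fun K).1 ?_
    have : v i ∈ V := by
      rw [← hv.span]
      exact Submodule.subset_span ⟨i, rfl⟩
    rwa [← hb.span] at this
  choose A hA using hmem
  have hAv : v = of A * b := by
    ext i j
    rw [← hA i]
    simp [mul_apply, Finset.sum_apply]
  have h1 : 1 ≤ ‖(of A).det‖ := by
    have h := hmin v hv
    rw [hAv, covol_mul] at h
    have hpos := covol_pos hb.linearIndependent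
    nlinarith
  rw [hAv, Matrix.mul_assoc, covol_mul]
  exact le_mul_of_one_le_left (norm_nonneg _) h1

lemma card_le_of_isChain (c : Finset (Submodule K (ι → K)))
    (hc : IsChain (· ≤ ·) (c : Set (Submodule K (ι → K)))) : c.card ≤ Fintype.card ι + 1 := by
  rw [← Finset.card_range (Fintype.card ι + 1)]
  refine Finset.card_le_card_of_injOn (fun V => Module.finrank K V) (fun V _ => ?_) ?_
  · have := Submodule.finrank_le V
    rw [Module.finrank_fintype_fun_eq_card] at this
    simpa using Nat.lt_succ_of_le this
  · intro V hV W hW h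
    rcases hc.total hV hW with hle | hle
    · exact Submodule.eq_of_le_of_finrank_eq hle h
    · exact (Submodule.eq_of_le_of_finrank_eq hle h.symm).symm

/-- At a marked point there is no short nonzero integral vector `w`. Take the largest `V` in the
chain, or `⊥`, that does not contain `w`: then `V + ⟨w⟩` is comparable with the chain, so its
covolume is not small, while by the Hadamard inequality it is at most that of `V` times the length
of `w`. -/
lemma le_norm_vecMul_of_isMarked [IsUltrametricDist K] {X : Type*}
    (hR : ∀ x ∈ R, x ≠ 0 → ∃ N : ℕ, ‖x‖ = Real.exp N) (N : X → Matrix ι ι K) {ε : ℝ} (hε : ε ≤ 1)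
    {x : X} (hx : IsMarked {V | IsRational R V} (fun V x => covol (minBasis R V * N x)) ε x)
    {w : ι → K} (hw : ∀ i, w i ∈ R) (hw0 : w ≠ 0) : ε ≤ ‖w ᵥ* N x‖ := by
  classical
  obtain ⟨c, hcP, hcc, hc1, hc2⟩ := hx
  let s := insert ⊥ (c.filter fun V => w ∉ V)
  obtain ⟨V, hVs, hVmax⟩ := s.exists_maximal ⟨⊥, Finset.mem_insert_self _ _⟩
  have hwV : w ∉ V := by
    rcases Finset.mem_insert.1 hVs with rfl | h
    · simpa using hw0
    · exact (Finset.mem_filter.1 h).2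
  have hV : IsRational R V := by
    rcases Finset.mem_insert.1 hVs with rfl | h
    · exact (isIntBasis_bot 0).isRational
    · exact hcP (Finset.mem_filter.1 h).1
  have hV1 : covol (minBasis R V * N x) ≤ 1 := by
    rcases Finset.mem_insert.1 hVs with rfl | h
    · exact (covol_minBasis_mul_le hR (isIntBasis_bot 0) _).trans
        (covol_le_one_of_rows_eq_zero _)
    · exact (hc1 V (Finset.mem_filter.1 h).1).2
  have hcomp : ∀ W ∈ c, V ≤ W ∨ W ≤ V := by
    intro W hW
    rcases Finset.mem_insert.1 hVs with rfl | h
    · exact Or.inl bot_le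
    · exact hcc.total (Finset.mem_filter.1 h).1 hW
  have hb := (minBasis_spec hR hV).1.cons hw hwV
  have hle : covol (minBasis R (V ⊔ Submodule.span K {w}) * N x) ≤ ‖w ᵥ* N x‖ := by
    refine (covol_minBasis_mul_le hR hb (N x)).trans ?_
    rw [vecCons_mul]
    exact (covol_cons_le _ _).trans (mul_le_of_le_one_right (norm_nonneg _) hV1)
  refine le_trans ?_ hle
  by_cases hmem : V ⊔ Submodule.span K {w} ∈ c
  · exact (hc1 _ hmem).1
  · refine hε.trans (hc2 _ hb.isRational hmem fun W hW => ?_)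
    by_cases hwW : w ∈ W
    · left
      refine sup_le ?_ (by simpa using hwW)
      rcases hcomp W hW with h | h
      · exact h
      · exact absurd (h hwW) hwV
    · right
      refine le_trans ?_ le_sup_left
      rcases hcomp W hW with h | h
      · exact hVmax (Finset.mem_insert_of_mem (Finset.mem_filter.2 ⟨hW, hwW⟩)) h
      · exact h

end Covolume

/-! ### Covolumes along the flow -/

section Flow

open Matrix

variable {K : Type*} [NormedField K] {n : ℕ}

/-- The matrix whose right multiplication sends a row `(p, q₁, …, q_n)`, with `p` at the index
`none`, to `(∑ yⱼ qⱼ - p, q₁, …, q_n)`. -/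
def unip (y : Fin n → K) : Matrix (Option (Fin n)) (Option (Fin n)) K :=
  of fun i j => j.elim (i.elim (-1) y) fun j => if i = some j then 1 else 0

/-- The matrix whose right multiplication sends a row `(p, q₁, …, q_n)` to
`(d₀ (∑ yⱼ qⱼ - p), d₁ q₁, …, d_n q_n)`. -/
def flow (d : Option (Fin n) → K) (y : Fin n → K) : Matrix (Option (Fin n)) (Option (Fin n)) K :=
  unip y * diagonal d

lemma mul_unip_none {r : ℕ} (v : Matrix (Fin r) (Option (Fin n)) K) (y : Fin n → K) (b : Fin r) :
    (v * unip y) b none = ∑ i, i.elim (-1) y * v b i := by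
  simp [mul_apply, unip, mul_comm]

lemma mul_unip_some {r : ℕ} (v : Matrix (Fin r) (Option (Fin n)) K) (y : Fin n → K) (b : Fin r)
    (j : Fin n) : (v * unip y) b (some j) = v b (some j) := by
  simp [mul_apply, unip]

lemma vecMul_flow_none (w : Option (Fin n) → K) (d : Option (Fin n) → K) (y : Fin n → K) :
    (w ᵥ* flow d y) none = (∑ j, y j * w (some j) - w none) * d none := by
  rw [flow, ← vecMul_vecMul, vecMul_diagonal]
  simp [vecMul, dotProduct, unip, Fintype.sum_option, mul_comm, sub_eq_add_neg, add_comm]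

lemma vecMul_flow_some (w : Option (Fin n) → K) (d : Option (Fin n) → K) (y : Fin n → K)
    (j : Fin n) : (w ᵥ* flow d y) (some j) = w (some j) * d (some j) := by
  rw [flow, ← vecMul_vecMul, vecMul_diagonal]
  simp [vecMul, dotProduct, unip]

lemma continuous_vecMul_flow (w : Option (Fin n) → K) (d : Option (Fin n) → K) :
    Continuous fun y => w ᵥ* flow d y := by
  refine continuous_pi fun i => ?_
  rcases i with _ | j
  · simp only [vecMul_flow_none]
    fun_prop
  · simp only [vecMul_flow_some]
    fun_prop

lemma minors_mul_diagonal {r : ℕ} (v : Matrix (Fin r) (Option (Fin n)) K)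
    (d : Option (Fin n) → K) (I : Fin r → Option (Fin n)) :
    minors (v * diagonal d) I = (∏ b, d (I b)) * minors v I := by
  rw [minors, minors, ← det_mul_row]
  congr 1
  ext a b
  simp [mul_comm]

lemma minors_mul_flow {r : ℕ} (v : Matrix (Fin r) (Option (Fin n)) K)
    (d : Option (Fin n) → K) (y : Fin n → K) (I : Fin r → Option (Fin n)) :
    minors (v * flow d y) I = (∏ b, d (I b)) * minors (v * unip y) I := by
  rw [flow, ← Matrix.mul_assoc, minors_mul_diagonal]

lemma minors_mul_unip_of_forall_ne_none {r : ℕ} (v : Matrix (Fin r) (Option (Fin n)) K)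
    (y : Fin n → K) {I : Fin r → Option (Fin n)} (hI : ∀ b, I b ≠ none) :
    minors (v * unip y) I = minors v I := by
  rw [minors, minors]
  congr 1
  ext a b
  obtain ⟨j, hj⟩ := Option.ne_none_iff_exists'.1 (hI b)
  rw [submatrix_apply, submatrix_apply, hj, mul_unip_some]

/-- As `y` occurs in a single column, the minors are affine in `y`. -/
lemma minors_mul_unip {r : ℕ} (v : Matrix (Fin r) (Option (Fin n)) K)
    (y : Fin n → K) {I : Fin r → Option (Fin n)} {a : Fin r} (ha : I a = none)
    (hI : Function.Injective I) :
    minors (v * unip y) I =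
      ∑ i, i.elim (-1) y * minors v (Function.update I a i) := by
  let col : Option (Fin n) → Fin r → K := fun i c => v c i
  have h1 : (fun b c => (v * unip y) c (I b)) =
      Function.update (fun b => col (I b)) a (∑ i, i.elim (-1) y • col i) := by
    funext b c
    by_cases hb : b = a
    · subst hb
      rw [Function.update_self, ha, mul_unip_none]
      simp [col, Finset.sum_apply]
    · obtain ⟨j, hj⟩ := Option.ne_none_iff_exists'.1 fun h : I b = none =>
        hb (hI (h.trans ha.symm))
      rw [Function.update_of_ne hb, hj, mul_unip_some]
  have h2 : ∀ (m : Matrix (Fin r) (Option (Fin n)) K) (J : Fin r → Option (Fin n)),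
      minors m J = (detRowAlternating (R := K)).toMultilinearMap fun b c => m c (J b) := by
    intro m J
    rw [minors, ← det_transpose]
    rfl
  rw [h2, h1, MultilinearMap.map_update_sum]
  refine Finset.sum_congr rfl fun i _ => ?_
  rw [MultilinearMap.map_update_smul, smul_eq_mul, h2]
  congr 2
  funext b c
  by_cases hb : b = a
  · subst hb
    simp [col]
  · simp [col, Function.update_of_ne hb]

lemma exists_minors_mul_flow_eq {r : ℕ} (v : Matrix (Fin r) (Option (Fin n)) K)
    (d : Option (Fin n) → K) (I : Fin r → Option (Fin n)) :
    ∃ (c₀ : K) (c : Fin n → K), ∀ y, minors (v * flow d y) I = c₀ + ∑ i, c i * y i := by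
  by_cases hI : Function.Injective I
  · by_cases hn : ∃ a, I a = none
    · obtain ⟨a, ha⟩ := hn
      refine ⟨-((∏ b, d (I b)) * minors v (Function.update I a none)),
        fun i => (∏ b, d (I b)) * minors v (Function.update I a (some i)), fun y => ?_⟩
      rw [minors_mul_flow, minors_mul_unip v y ha hI, Fintype.sum_option, mul_add, Finset.mul_sum]
      congr 1
      · simp
      · exact Finset.sum_congr rfl fun i _ => by
          simp only [Option.elim_some]
          ring
    · refine ⟨(∏ b, d (I b)) * minors v I, 0, fun y => ?_⟩
      rw [minors_mul_flow, minors_mul_unip_of_forall_ne_none v y (not_exists.1 hn)]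
      simp
  · exact ⟨0, 0, fun y => by simp [minors_apply_eq_zero _ hI]⟩

/-- The weight of a minor that contains the column `none`: the weights of all columns multiply to
`1`, and the columns that are left out have weights `e ^ (-tⱼ)`. -/
lemma exp_le_prod_norm {d : Option (Fin n) → K} {t : Fin n → ℕ}
    (hd0 : ‖d none‖ = Real.exp ((∑ j, t j : ℕ) : ℝ))
    (hd : ∀ j, ‖d (some j)‖ = Real.exp (-(t j : ℝ)))
    {r : ℕ} {I : Fin r → Option (Fin n)} {a : Fin r} (ha : I a = none)
    (hI : Function.Injective I) :
    1 ≤ ‖∏ b, d (I b)‖ ∧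
      ∀ j, some j ∉ Set.range I → Real.exp (t j) ≤ ‖∏ b, d (I b)‖ := by
  classical
  let w : Option (Fin n) → ℝ := fun i => i.elim ((∑ j, t j : ℕ) : ℝ) fun j => -(t j : ℝ)
  have hw : ∀ i, ‖d i‖ = Real.exp (w i) := by
    rintro (_ | j)
    · exact hd0
    · exact hd j
  have hsum : ∑ b, w (I b) = ∑ i ∈ (Finset.univ.image I)ᶜ, -w i := by
    have h0 : ∑ i, w i = 0 := by simp [Fintype.sum_option, w]
    rw [← Finset.sum_add_sum_compl (Finset.univ.image I), Finset.sum_image fun x _ y _ h => hI h]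
      at h0
    rw [Finset.sum_neg_distrib]
    linarith
  have hpos : ∀ i ∈ (Finset.univ.image I)ᶜ, 0 ≤ -w i := by
    rintro (_ | j) hi
    · simp only [Finset.mem_compl, Finset.mem_image, Finset.mem_univ, true_and, not_exists] at hi
      exact absurd ha (hi a)
    · simp [w]
  have hprod : ‖∏ b, d (I b)‖ = Real.exp (∑ b, w (I b)) := by
    rw [norm_prod, Real.exp_sum]
    exact Finset.prod_congr rfl fun b _ => hw _
  rw [hprod, hsum]
  refine ⟨Real.one_le_exp (Finset.sum_nonneg hpos), fun j hj => Real.exp_le_exp.2 ?_⟩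
  have := Finset.single_le_sum hpos (a := some j) (by simpa using hj)
  simpa [w] using this

/-- The combinatorial core of the lower bound for covolumes: if some minor does not vanish, there is
an affine minor with a nonzero coefficient which either leaves out the column `j` or is constant. -/
lemma exists_affine_minor {r : ℕ} (hr : 0 < r) (v : Matrix (Fin r) (Option (Fin n)) K)
    (hv : minors v ≠ 0) (j : Fin n) :
    ∃ (I : Fin r → Option (Fin n)) (a : Fin r), Function.Injective I ∧ I a = none ∧
      (∃ i, minors v (Function.update I a i) ≠ 0) ∧
      (some j ∉ Set.range I ∨ ∀ i, i ≠ none → minors v (Function.update I a i) = 0) := by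
  by_contra hcon
  have hinj : ∀ I, minors v I ≠ 0 → Function.Injective I := fun I hI => by
    by_contra h
    exact hI (minors_apply_eq_zero v h)
  have key : ∀ I a, minors v I ≠ 0 → ¬ ∀ b ≠ a, I b ≠ none ∧ I b ≠ some j := by
    intro I a hI h
    refine hcon ⟨Function.update I a none, a, ?_, Function.update_self .., ⟨I a, by simpa⟩,
      Or.inl ?_⟩
    · intro b c hbc
      by_cases hb : b = a <;> by_cases hc : c = a
      · rw [hb, hc]
      · subst hb
        rw [Function.update_self, Function.update_of_ne hc] at hbc
        exact absurd hbc.symm (h c hc).1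
      · subst hc
        rw [Function.update_self, Function.update_of_ne hb] at hbc
        exact absurd hbc (h b hb).1
      · rw [Function.update_of_ne hb, Function.update_of_ne hc] at hbc
        exact hinj I hI hbc
    · rintro ⟨b, hb⟩
      by_cases hba : b = a
      · subst hba
        simp at hb
      · rw [Function.update_of_ne hba] at hb
        exact (h b hba).2 hb
  have hnone : ∀ I, minors v I ≠ 0 → ∃ a, I a = none := by
    intro I hI
    by_contra! h
    by_cases hj : ∃ a, I a = some j
    · obtain ⟨a, ha⟩ := hj
      exact key I a hI fun b hb => ⟨h b, fun hbj => hb (hinj I hI (hbj.trans ha.symm))⟩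
    · exact key I ⟨0, hr⟩ hI fun b _ => ⟨h b, not_exists.1 hj b⟩
  obtain ⟨I, hI⟩ := Function.ne_iff.1 hv
  obtain ⟨a, ha⟩ := hnone I hI
  refine hcon ⟨I, a, hinj I hI, ha, ⟨I a, by simpa⟩, Or.inr fun i hi => ?_⟩
  by_contra h0
  obtain ⟨b, hb⟩ := hnone _ h0
  by_cases hba : b = a
  · subst hba
    rw [Function.update_self] at hb
    exact hi hb
  · rw [Function.update_of_ne hba] at hb
    exact hba (hinj I hI (hb.trans ha.symm))

/-- If affine functions with a coefficient of absolute value at least `1` reach the value `c` on the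
set `Y`, then all covolumes of integral matrices reach the value `1` on `Y` as soon as the flow
expands by at least `c⁻¹`. -/
lemma exists_one_le_covol_mul_flow {R : Subring K} (hR : ∀ x ∈ R, x ≠ 0 → 1 ≤ ‖x‖)
    {d : Option (Fin n) → K} {t : Fin n → ℕ}
    (hd0 : ‖d none‖ = Real.exp ((∑ j, t j : ℕ) : ℝ))
    (hd : ∀ j, ‖d (some j)‖ = Real.exp (-(t j : ℝ)))
    {Y : Set (Fin n → K)} (hY : Y.Nonempty) {c : ℝ} (hc : 0 < c)
    (hYc : ∀ a : Option (Fin n) → K, 1 ≤ ‖a‖ → ∃ y ∈ Y, c ≤ ‖∑ i, i.elim (-1) y * a i‖)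
    {j : Fin n} (hj : 1 ≤ Real.exp (t j) * c) {r : ℕ} {v : Matrix (Fin r) (Option (Fin n)) K}
    (hvR : ∀ i j, v i j ∈ R) (hv : minors v ≠ 0) :
    ∃ y ∈ Y, 1 ≤ covol (v * flow d y) := by
  rcases Nat.eq_zero_or_pos r with rfl | hr
  · obtain ⟨y, hy⟩ := hY
    refine ⟨y, hy, le_trans (le_of_eq ?_) (norm_le_pi_norm _ Fin.elim0)⟩
    simp [minors]
  obtain ⟨I, a, hI, ha, ⟨i₀, hi₀⟩, hor⟩ := exists_affine_minor hr v hv j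
  have hone : 1 ≤ ‖minors v (Function.update I a i₀)‖ := hR _ (minors_mem hvR _) hi₀
  obtain ⟨hw1, hwj⟩ := exp_le_prod_norm hd0 hd ha hI
  rcases hor with hor | hor
  · obtain ⟨y, hy, hyc⟩ := hYc (fun i => minors v (Function.update I a i))
      (hone.trans (norm_le_pi_norm (fun i => minors v (Function.update I a i)) i₀))
    refine ⟨y, hy, le_trans ?_ (norm_le_pi_norm _ I)⟩
    rw [minors_mul_flow, norm_mul, minors_mul_unip v y ha hI]
    refine hj.trans ?_
    gcongr
    exact hwj j hor
  · obtain ⟨y, hy⟩ := hY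
    refine ⟨y, hy, le_trans ?_ (norm_le_pi_norm _ I)⟩
    have hi₀' : i₀ = none := by
      by_contra h
      exact hi₀ (hor i₀ h)
    subst hi₀'
    rw [minors_mul_flow, norm_mul, minors_mul_unip v y ha hI,
      Finset.sum_eq_single none (fun i _ hi => by rw [hor i hi, mul_zero]) (by simp)]
    simp only [Option.elim_none, neg_mul, one_mul, norm_neg]
    exact one_le_mul_of_one_le_of_one_le hw1 hone

/-- Linear independence of finitely many functions is uniform, by compactness of the unit sphere. -/
lemma exists_forall_le_norm_sum [ProperSpace K] {ι S : Type*} [Fintype ι] {g : ι → S → K}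
    (hg : LinearIndependent K g) :
    ∃ c : ℝ, 0 < c ∧ ∀ a : ι → K, 1 ≤ ‖a‖ → ∃ x, c ≤ ‖∑ i, a i * g i x‖ := by
  let U : ℕ → Set (ι → K) := fun m => {a | ∃ x, 1 / ((m : ℝ) + 1) < ‖∑ i, a i * g i x‖}
  obtain ⟨m, hm⟩ := (isCompact_sphere (0 : ι → K) 1).elim_directed_cover U (fun m => by
      have : U m = ⋃ x, {a | 1 / ((m : ℝ) + 1) < ‖∑ i, a i * g i x‖} := by
        ext a
        simp [U]
      rw [this]
      exact isOpen_iUnion fun x => isOpen_lt continuous_const (by fun_prop)) (by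
      intro a ha
      have ha0 : a ≠ 0 := by
        rintro rfl
        simp at ha
      have h0 : ∑ i, a i • g i ≠ 0 := fun h =>
        ha0 (funext fun i => Fintype.linearIndependent_iff.1 hg a h i)
      obtain ⟨x, hx⟩ := Function.ne_iff.1 h0
      rw [Finset.sum_apply] at hx
      obtain ⟨m, hm⟩ := exists_nat_one_div_lt (norm_pos_iff.2 hx)
      exact Set.mem_iUnion.2 ⟨m, x, hm⟩) (by
      refine Monotone.directed_le fun m m' hmm' a ⟨x, hx⟩ => ⟨x, lt_of_le_of_lt ?_ hx⟩
      exact one_div_le_one_div_of_le (by positivity) (by gcongr))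
  refine ⟨1 / ((m : ℝ) + 1), by positivity, fun a ha => ?_⟩
  have hne : Nonempty ι := by
    by_contra h
    have := not_nonempty_iff.1 h
    rw [Subsingleton.elim a 0, norm_zero] at ha
    linarith
  obtain ⟨i, hi⟩ := Finite.exists_max fun i => ‖a i‖
  have hai : ‖a‖ = ‖a i‖ :=
    ((pi_norm_le_iff_of_nonneg (norm_nonneg _)).2 hi).antisymm (norm_le_pi_norm a i)
  have hai0 : a i ≠ 0 := by
    rw [← norm_pos_iff, ← hai]
    linarith
  obtain ⟨x, hx⟩ := hm (show (a i)⁻¹ • a ∈ sphere 0 1 by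
    rw [mem_sphere_zero_iff_norm, norm_smul, norm_inv, hai,
      inv_mul_cancel₀ (norm_ne_zero_iff.2 hai0)])
  refine ⟨x, hx.le.trans ?_⟩
  have hsum : ∑ j, ((a i)⁻¹ • a) j * g j x = (a i)⁻¹ * ∑ j, a j * g j x := by
    rw [Finset.mul_sum]
    exact Finset.sum_congr rfl fun j _ => by simp [mul_assoc]
  rw [hsum, norm_mul, norm_inv, ← hai]
  exact mul_le_of_le_one_left (norm_nonneg _) (inv_le_one_of_one_le₀ ha)

end Flow

/-! ### Short vectors and Dirichlet improvability -/

section ShortVectors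

open Matrix

open scoped ENNReal

variable (k : Type*) [Field k] {n : ℕ}

/-- The diagonal flow `(T ^ (t₁ + ⋯ + t_n), T ^ (-t₁), …, T ^ (-t_n))`. -/
def flowDiag (t : Fin n → ℕ) : Option (Fin n) → LaurentInv k :=
  fun i => i.elim (elemT k ^ ((∑ j, t j : ℕ) : ℤ)) fun j => elemT k ^ (-(t j : ℤ))

lemma norm_flowDiag_none (t : Fin n → ℕ) :
    ‖flowDiag k t none‖ = Real.exp ((∑ j, t j : ℕ) : ℝ) := by
  rw [flowDiag, Option.elim_none, norm_elemT_zpow, Int.cast_natCast]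

lemma norm_flowDiag_some (t : Fin n → ℕ) (j : Fin n) :
    ‖flowDiag k t (some j)‖ = Real.exp (-(t j : ℝ)) := by
  rw [flowDiag, Option.elim_some, norm_elemT_zpow]
  push_cast
  rfl

/-- The lattice `Λ ^ (n + 1)`, moved by `y` and by the flow at time `t`, contains a nonzero vector
of norm less than `ε`. -/
def HasShortVector (ε : ℝ) (t : Fin n → ℕ) (y : Fin n → LaurentInv k) : Prop :=
  ∃ w : Option (Fin n) → LaurentInv k, (∀ i, w i ∈ (polyEmb k).range) ∧ w ≠ 0 ∧
    ‖w ᵥ* flow (flowDiag k t) y‖ < ε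

lemma isOpen_setOf_hasShortVector (ε : ℝ) (t : Fin n → ℕ) :
    IsOpen {y | HasShortVector k ε t y} := by
  have : {y | HasShortVector k ε t y} = ⋃ (w : Option (Fin n) → LaurentInv k)
      (_ : ∀ i, w i ∈ (polyEmb k).range) (_ : w ≠ 0),
        {y | ‖w ᵥ* flow (flowDiag k t) y‖ < ε} := by
    ext y
    simp only [HasShortVector, Set.mem_iUnion, exists_prop, Set.mem_ofPred_eq]
  rw [this]
  refine isOpen_iUnion fun w => isOpen_iUnion fun _ => isOpen_iUnion fun _ => ?_
  exact isOpen_lt (continuous_vecMul_flow w _).norm continuous_const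

lemma sum_inr_eq_of_mem_aPlus {t : Fin 1 ⊕ Fin n → ℕ} (ht : t ∈ aPlus 1 n) :
    t (Sum.inl 0) = ∑ j, t (Sum.inr j) := by
  have : ∑ i, t (Sum.inl i) = ∑ j, t (Sum.inr j) := ht
  simpa using this

lemma tupleNorm_le_of_mem_aPlus {t : Fin 1 ⊕ Fin n → ℕ} (ht : t ∈ aPlus 1 n) :
    tupleNorm t ≤ ∑ j, t (Sum.inr j) := by
  refine Finset.sup_le ?_
  rintro (i | j) _
  · rw [Subsingleton.elim i 0, sum_inr_eq_of_mem_aPlus ht]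
  · exact Finset.single_le_sum (f := fun j => t (Sum.inr j)) (fun _ _ => Nat.zero_le _)
      (Finset.mem_univ j)

/-- Dani's correspondence: solutions of Dirichlet's inequalities are short lattice vectors. -/
lemma exists_hasShortVector_of_mem_DI {ε : ℝ} (hε : 0 < ε) {𝒯 : Set (Fin 1 ⊕ Fin n → ℕ)}
    (h𝒯 : 𝒯 ⊆ aPlus 1 n) {y : Fin n → LaurentInv k} (hy : y ∈ DI k ε 𝒯) :
    ∃ s : ℕ, ∀ t ∈ 𝒯, s < tupleNorm t → HasShortVector k ε (fun j => t (Sum.inr j)) y := by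
  obtain ⟨t₀, -, h⟩ := hy
  refine ⟨⌈t₀⌉₊, fun t ht hlt => ?_⟩
  obtain ⟨p, q, hpq, hp, hq⟩ := h t ht ((Nat.le_ceil t₀).trans_lt (by exact_mod_cast hlt))
  refine ⟨fun i => i.elim (polyEmb k (p 0)) fun j => polyEmb k (q j), ?_, ?_, ?_⟩
  · rintro (_ | j)
    · exact ⟨_, rfl⟩
    · exact ⟨_, rfl⟩
  · intro h0
    refine hpq (Prod.ext (funext fun i => ?_) (funext fun j => ?_))
    · rw [Subsingleton.elim i 0]
      exact polyEmb_injective k ((congrFun h0 none).trans (polyEmb k).map_zero.symm)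
    · exact polyEmb_injective k ((congrFun h0 (some j)).trans (polyEmb k).map_zero.symm)
  · rw [pi_norm_lt_iff hε]
    rintro (_ | j)
    · rw [vecMul_flow_none, norm_mul, norm_flowDiag_none, ← sum_inr_eq_of_mem_aPlus (h𝒯 ht),
        ← lt_div_iff₀ (Real.exp_pos _)]
      exact hp 0
    · rw [vecMul_flow_some, norm_mul, norm_flowDiag_some, Real.exp_neg,
        ← div_eq_mul_inv, div_lt_iff₀ (Real.exp_pos _)]
      exact hq j

end ShortVectors

/-! ### Nondivergence along nonplanar maps -/

section Nondivergence

open Matrix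

open scoped ENNReal

variable {X K : Type*} [PseudoMetricSpace X] [NormedField K] {n : ℕ}

lemma continuousOn_covol_mul_flow {r : ℕ} (v : Matrix (Fin r) (Option (Fin n)) K)
    (d : Option (Fin n) → K) {f : X → Fin n → K} {B : Set X} (hf : ContinuousOn f B) :
    ContinuousOn (fun x => covol (v * flow d (f x))) B := by
  refine ContinuousOn.norm (continuousOn_pi.2 fun I => ?_)
  obtain ⟨c₀, c, h⟩ := exists_minors_mul_flow_eq v d I
  simp only [h]
  have hfi := continuousOn_pi.1 hf
  fun_prop

variable [MeasurableSpace X]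

/-- Covolumes inherit goodness from affine combinations of the `f i`, as the largest minor at a
point where the covolume is at least `1` is such a combination. -/
lemma measure_covol_lt_le {C α : ℝ} (hα : 0 < α) {f : X → Fin n → K} {U : Set X} {ν : Measure X}
    (hgood : IsGoodMap C α f U ν) {r : ℕ} (v : Matrix (Fin r) (Option (Fin n)) K)
    (d : Option (Fin n) → K) {ε : ℝ} (hε : 0 < ε) {x : X} (hx : x ∈ ν.support) {ρ : ℝ} (hρ : 0 < ρ)
    (hU : ball x ρ ⊆ U) (h1 : ∃ y ∈ ball x ρ ∩ ν.support, 1 ≤ covol (v * flow d (f y))) :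
    ν {y ∈ ball x ρ | covol (v * flow d (f y)) < ε} ≤
      ENNReal.ofReal C * ENNReal.ofReal ε ^ α * ν (ball x ρ) := by
  obtain ⟨y, hy, hy1⟩ := h1
  have h0 : minors (v * flow d (f y)) ≠ 0 := by
    rw [← norm_pos_iff]
    exact one_pos.trans_le hy1
  obtain ⟨I, -, hI⟩ := exists_norm_minors_eq_covol h0
  obtain ⟨c₀, c, h⟩ := exists_minors_mul_flow_eq v d I
  have hsup : 1 ≤ ⨆ y ∈ ball x ρ ∩ ν.support, ‖c₀ + ∑ i, c i * f y i‖ₑ := by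
    refine le_trans ?_ (le_iSup₂ (f := fun y _ => ‖c₀ + ∑ i, c i * f y i‖ₑ) y hy)
    rw [← h, ← ofReal_norm, hI]
    exact ENNReal.one_le_ofReal.2 hy1
  calc ν {y ∈ ball x ρ | covol (v * flow d (f y)) < ε}
      ≤ ν {y ∈ ball x ρ | ‖c₀ + ∑ i, c i * f y i‖ < ε} := by
        refine measure_mono fun z hz => ⟨hz.1, lt_of_le_of_lt ?_ hz.2⟩
        rw [← h]
        exact norm_le_pi_norm _ I
    _ ≤ _ := hgood c₀ c x hx ρ hρ hU ε hε
    _ ≤ _ := by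
        gcongr
        exact ENNReal.div_le_of_le_mul (le_mul_of_one_le_right' hsup)

/-- Nonplanarity makes affine functions uniformly large on a ball. -/
lemma exists_forall_le_norm_of_isNonplanar [ProperSpace K] {f : X → Fin n → K} {U : Set X}
    {ν : Measure X} (hf : IsNonplanar f U ν) {x : X} (hx : x ∈ ν.support) {ρ : ℝ} (hρ : 0 < ρ)
    (hU : ball x ρ ⊆ U) :
    ∃ c : ℝ, 0 < c ∧ ∀ a : Option (Fin n) → K, 1 ≤ ‖a‖ →
      ∃ y ∈ f '' (ball x ρ ∩ ν.support), c ≤ ‖∑ i, i.elim (-1) y * a i‖ := by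
  obtain ⟨c, hc, h⟩ := exists_forall_le_norm_sum (hf x hx ρ hρ hU)
  refine ⟨c, hc, fun a ha => ?_⟩
  let a' : Option (Fin n) → K := fun i => i.elim (-a none) fun j => a (some j)
  have ha' : ‖a‖ ≤ ‖a'‖ := by
    refine (pi_norm_le_iff_of_nonneg (norm_nonneg _)).2 ?_
    rintro (_ | j)
    · rw [← norm_neg]
      exact norm_le_pi_norm a' none
    · exact norm_le_pi_norm a' (some j)
  obtain ⟨z, hz⟩ := h a' (ha.trans ha')
  refine ⟨f z, ⟨z, z.2, rfl⟩, hz.trans (le_of_eq ?_)⟩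
  simp [Fintype.sum_option, a', mul_comm]

end Nondivergence

section Field

open Matrix

open scoped ENNReal

variable {k : Type*} [Field k] [Finite k] {n : ℕ}
  {X : Type*} [PseudoMetricSpace X] [IsUltrametricDist X] [MeasurableSpace X]
  [OpensMeasurableSpace X] [SecondCountableTopology X]

/-- In a fixed ball, the points with an `ε`-short vector at time `t` have a small proportion, once
`t` is large. -/
lemma exists_forall_measure_hasShortVector_le {C α D : ℝ} (hα : 0 < α)
    {ν : Measure X} {U : Set X} (hfed : IsFederer D U ν) {f : X → Fin n → LaurentInv k}
    (hcont : ContinuousOn f U) (hgood : IsGoodMap C α f U ν) (hplan : IsNonplanar f U ν)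
    {ε : ℝ} (hε : 0 < ε) (hε1 : ε ≤ 1) {x : X} (hx : x ∈ ν.support) {m : ℤ}
    (hU : ball x (3 ^ m) ⊆ U) :
    ∃ N : ℕ, ∀ t : Fin n → ℕ, N < ∑ j, t j →
      ν {z ∈ ball x (3 ^ m) | HasShortVector k ε t (f z)} ≤
        ENNReal.ofReal C * ENNReal.ofReal ε ^ α * markedConst (ENNReal.ofReal D) (n + 2) *
          ν (ball x (3 ^ m)) := by
  obtain ⟨c, hc, hYc⟩ := exists_forall_le_norm_of_isNonplanar hplan hx (three_zpow_pos m) hU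
  obtain ⟨L, hL⟩ := exists_nat_gt (-Real.log c)
  refine ⟨n * L, fun t ht => ?_⟩
  obtain ⟨j, hj⟩ : ∃ j, L ≤ t j := by
    by_contra! h
    have := Finset.sum_le_card_nsmul Finset.univ t L fun j _ => (h j).le
    rw [Finset.card_univ, Fintype.card_fin, smul_eq_mul] at this
    exact absurd ht this.not_gt
  have hjc : 1 ≤ Real.exp (t j) * c := by
    rw [← Real.exp_log hc, ← Real.exp_add]
    refine Real.one_le_exp ?_
    have : (L : ℝ) ≤ t j := by exact_mod_cast hj
    linarith
  let R : Subring (LaurentInv k) := (polyEmb k).range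
  have hR : ∀ z ∈ R, z ≠ 0 → ∃ N : ℕ, ‖z‖ = Real.exp N := fun z hz hz0 =>
    exists_norm_eq_exp k hz hz0
  let N : X → Matrix (Option (Fin n)) (Option (Fin n)) (LaurentInv k) := fun z =>
    flow (flowDiag k t) (f z)
  refine le_trans ?_ (measure_not_isMarked_le ν
    (fun V z => covol (minBasis R V * N z)) ε _ _ (n + 2) {V | IsRational R V} x m ?_ ?_ ?_ ?_ ?_)
  · refine measure_mono ?_
    rintro z ⟨hz, w, hwR, hw0, hw⟩
    exact ⟨hz, fun hmark => (le_norm_vecMul_of_isMarked hR N hε1 hmark hwR hw0).not_gt hw⟩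
  · intro c _ hcc
    simpa using card_le_of_isChain c hcc
  · intro V hV
    have hb := (minBasis_spec hR hV).1
    have hne : (ball x ((3 : ℝ) ^ m) ∩ ν.support).Nonempty :=
      ⟨x, mem_ball_self (three_zpow_pos m), hx⟩
    obtain ⟨_, ⟨z, hz, rfl⟩, h⟩ := exists_one_le_covol_mul_flow
      (fun z hz hz0 => one_le_norm_of_mem_range k hz hz0)
      (norm_flowDiag_none k t) (norm_flowDiag_some k t)
      (hne.image f) hc hYc hjc hb.mem
      (minors_ne_zero hb.linearIndependent)
    exact ⟨z, hz, h⟩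
  · intro V _
    exact continuousOn_covol_mul_flow _ _ (hcont.mono hU)
  · intro V _ z hz l hl h1
    exact measure_covol_lt_le hα hgood _ _ hε hz (three_zpow_pos l) (hl.trans hU) h1
  · intro z hz l hl
    rw [zpow_add_one₀ (by norm_num), mul_comm] at hl ⊢
    exact hfed z hz _ (three_zpow_pos l) (hl.trans hU)

/-- The points that have `ε`-short vectors at all large times in an unbounded set are null. -/
lemma measure_setOf_hasShortVector_eq_zero [ProperSpace X] {C α D : ℝ} (hα : 0 < α)
    {ν : Measure X} [ν.Regular] {U : Set X} (hUo : IsOpen U) (hfed : IsFederer D U ν)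
    {f : X → Fin n → LaurentInv k}
    (hcont : ContinuousOn f U) (hgood : IsGoodMap C α f U ν) (hplan : IsNonplanar f U ν)
    {ε : ℝ} (hε : 0 < ε) (hε1 : ε ≤ 1)
    (hlt : ENNReal.ofReal C * ENNReal.ofReal ε ^ α * markedConst (ENNReal.ofReal D) (n + 2) < 1)
    {𝒯 : Set (Fin 1 ⊕ Fin n → ℕ)} (h𝒯 : 𝒯 ⊆ aPlus 1 n) (hunb : IsUnbounded 𝒯) (s : ℕ) :
    ν {x ∈ U | ∀ t ∈ 𝒯, s < tupleNorm t →
      HasShortVector k ε (fun j => t (Sum.inr j)) (f x)} = 0 := by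
  rcases isEmpty_or_nonempty X with hX | ⟨⟨x₀⟩⟩
  · rw [Set.eq_empty_of_isEmpty {x ∈ U | _}, measure_empty]
  set A := {x ∈ U | ∀ t ∈ 𝒯, s < tupleNorm t →
    HasShortVector k ε (fun j => t (Sum.inr j)) (f x)} with hA
  have hcover : A = ⋃ i : ℕ, A ∩ ball x₀ i := by
    rw [← Set.inter_iUnion, iUnion_ball_nat, Set.inter_univ]
  rw [hcover]
  refine measure_iUnion_null fun i => ?_
  refine measure_eq_zero_of_ball_proportion ν _ ?_ _ hlt ?_
  · exact ((measure_mono Set.inter_subset_right).trans_lt measure_ball_lt_top).ne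
  rintro x ⟨⟨hxA, -⟩, hxs⟩
  obtain ⟨r, hr, hrU⟩ := Metric.isOpen_iff.1 hUo x hxA.1
  obtain ⟨M, hM⟩ := exists_pow_lt_of_lt_one hr (show (3⁻¹ : ℝ) < 1 by norm_num)
  refine ⟨-M, fun m hm => ?_⟩
  have hU : ball x ((3 : ℝ) ^ m) ⊆ U := by
    refine ((ball_three_zpow_mono x hm).trans (ball_subset_ball ?_)).trans hrU
    rw [_root_.zpow_neg, zpow_natCast, ← inv_pow]
    exact hM.le
  obtain ⟨N, hN⟩ := exists_forall_measure_hasShortVector_le hα hfed hcont hgood hplan hε hε1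
    hxs hU
  obtain ⟨t, ht, hlt'⟩ := hunb (max N s)
  refine le_trans (measure_mono ?_) (hN (fun j => t (Sum.inr j)) ?_)
  · rintro z ⟨⟨hzA, -⟩, hz⟩
    exact ⟨hz, hzA.2 t ht (by omega)⟩
  · have := tupleNorm_le_of_mem_aPlus (h𝒯 ht)
    omega

end Field

/-- The proportion in the nondivergence estimate is less than `1` for small `ε`. -/
lemma exists_forall_proportion_lt_one {C α : ℝ} (hα : 0 < α) {M : ENNReal} (hM : M ≠ ⊤) :
    ∃ ε₀ : ℝ, 0 < ε₀ ∧ ∀ ε, 0 < ε → ε < ε₀ →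
      ENNReal.ofReal C * ENNReal.ofReal ε ^ α * M < 1 := by
  have h : Filter.Tendsto (fun ε => ENNReal.ofReal C * ENNReal.ofReal ε ^ α * M) (nhds 0)
      (nhds 0) := by
    have h1 : Filter.Tendsto (fun ε => ENNReal.ofReal ε ^ α) (nhds 0) (nhds 0) := by
      have : Continuous fun ε => ENNReal.ofReal ε ^ α :=
        ENNReal.continuous_rpow_const.comp ENNReal.continuous_ofReal
      simpa [ENNReal.zero_rpow_of_pos hα] using this.tendsto 0
    have h2 := ENNReal.Tendsto.mul_const
      (ENNReal.Tendsto.const_mul h1 (Or.inr (ENNReal.ofReal_ne_top (r := C)))) (Or.inr hM)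
    simpa using h2
  obtain ⟨ε₀, hε₀, hball⟩ := Metric.eventually_nhds_iff_ball.1
    (h.eventually_lt_const (show (0 : ENNReal) < 1 from one_pos))
  refine ⟨ε₀, hε₀, fun ε hε hlt => hball ε ?_⟩
  rw [mem_ball, Real.dist_0_eq_abs, abs_of_pos hε]
  exact hlt

end DirichletFF

end

/-! ### The theorem on Dirichlet improvable vectors -/

theorem theorem3p1 (n : ℕ) (hn : 0 < n) (C α D : ℝ) (hC : 0 < C) (hα : 0 < α) (hD : 0 < D) :
    ∃ ε₀ : ℝ, 0 < ε₀ ∧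
      ∀ (k : Type*) [Field k] [Finite k] (d : ℕ), 0 < d →
      ∀ (ν : Measure (Fin d → DirichletFF.LaurentInv k)) [ν.Regular]
        (U : Set (Fin d → DirichletFF.LaurentInv k)),
        IsOpen U → 0 < ν U → DirichletFF.IsFederer D U ν →
      ∀ f : (Fin d → DirichletFF.LaurentInv k) → (Fin n → DirichletFF.LaurentInv k),
        ContinuousOn f U → DirichletFF.IsGoodMap C α f U ν → DirichletFF.IsNonplanar f U ν →
      ∀ ε : ℝ, 0 < ε → ε < ε₀ →
      ∀ 𝒯 : Set (Fin 1 ⊕ Fin n → ℕ), 𝒯 ⊆ DirichletFF.aPlus 1 n → DirichletFF.IsUnbounded 𝒯 →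
        Measure.map f (ν.restrict U) (DirichletFF.DI k ε 𝒯) = 0 := by
  obtain ⟨ε₁, hε₁, hlt⟩ := DirichletFF.exists_forall_proportion_lt_one (C := C) hα
    (DirichletFF.markedConst_ne_top (ENNReal.ofReal_ne_top (r := D)) (n + 2))
  refine ⟨min ε₁ 1, lt_min hε₁ one_pos, ?_⟩
  intro k _ _ d _ ν _ U hUo _ hfed f hcont hgood hplan ε hε hεlt 𝒯 h𝒯 hunb
  obtain ⟨hε1, hε2⟩ := lt_min_iff.1 hεlt
  let S : Set (Fin n → DirichletFF.LaurentInv k) :=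
    ⋃ s : ℕ, ⋂ t ∈ 𝒯, ⋂ _ : s < DirichletFF.tupleNorm t,
      {y | DirichletFF.HasShortVector k ε (fun j => t (Sum.inr j)) y}
  -- The superset `S` of `DI k ε 𝒯` is measurable, so its measure under the pushforward is that of
  -- its preimage.
  have hS : MeasurableSet S :=
    MeasurableSet.iUnion fun s => MeasurableSet.biInter 𝒯.to_countable fun t _ =>
      MeasurableSet.iInter fun _ =>
        (DirichletFF.isOpen_setOf_hasShortVector k ε _).measurableSet
  have hsub : DirichletFF.DI k ε 𝒯 ⊆ S := by
    intro y hy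
    obtain ⟨s, hs⟩ := DirichletFF.exists_hasShortVector_of_mem_DI k hε h𝒯 hy
    exact Set.mem_iUnion.2 ⟨s, Set.mem_iInter₂.2 fun t ht => Set.mem_iInter.2 (hs t ht)⟩
  refine measure_mono_null hsub ?_
  rw [Measure.map_apply_of_aemeasurable (hcont.aemeasurable hUo.measurableSet) hS,
    Measure.restrict_apply' hUo.measurableSet]
  refine measure_mono_null (t := ⋃ s : ℕ, {x ∈ U | ∀ t ∈ 𝒯, s < DirichletFF.tupleNorm t →
    DirichletFF.HasShortVector k ε (fun j => t (Sum.inr j)) (f x)}) ?_ ?_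
  · rintro x ⟨hx, hxU⟩
    obtain ⟨s, hs⟩ := Set.mem_iUnion.1 hx
    refine Set.mem_iUnion.2 ⟨s, hxU, fun t ht hst => ?_⟩
    exact Set.mem_iInter.1 (Set.mem_iInter₂.1 hs t ht) hst
  · exact measure_iUnion_null fun s => DirichletFF.measure_setOf_hasShortVector_eq_zero hα hUo
      hfed hcont hgood hplan hε hε2.le (hlt ε hε hε1) h𝒯 hunb s
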